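/- Let $(W,\omega)$ be a symplectic manifold with concave boundary modelled on a contact manifold $(Y,\theta)$ ($\theta$ a contact form): there are $c>0$, $\epsilon>0$ and a diffeomorphism from $Y\times[c,c+\epsilon)$ onto an open neighbourhood of $\partial W$, taking $Y\times\{c\}$ onto $\partial W$ and pulling $\omega$ back to $d(\rho\,\theta)$, where $\rho\in[c,c+\epsilon)$ is the second coordinate. Use it to identify $\partial W$ with $Y$ and to regard $\rho$ and $\theta$ as defined near $Y$ in $W$. Let $\Sigma$ be a compact surface with boundary, with complex structure $j$, such that every connected component of $\Sigma$ has non-empty boundary (for instance $\Sigma$ connected and $\partial\Sigma\neq\emptyset$). Let $(J_z)_{z\in\Sigma}$ be a smooth family of $\omega$-compatible almost complex structures on $W$, and let $\mathcal K\in\Omega^1(\Sigma;C^\infty(W))$ be a (jointly smooth) one-form on $\Sigma$ with values in functions on $W$. For a function $f$ on $W$ let $X_f$ be given by $\omega(X_f,\cdot)=df$, put $\{f,g\}=\omega(X_f,X_g)$, let $X_{\mathcal K}(v)=X_{\mathcal K(v)}$ and $\{\mathcal K,\mathcal K\}(v,w)=\{\mathcal K(v),\mathcal K(w)\}$, and let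 $d_\Sigma\mathcal K$ be the exterior derivative of $\mathcal K$ in the $\Sigma$-directions. Suppose that: 1. $J_z$ is of contact type along $Y$ for all $z\in\partial\Sigma$: $d\rho\circ J_z=-\rho\,\theta$ at the points of $Y$; 2. there are one-forms $\alpha,\beta\in\Omega^1(\Sigma)$ such that $\mathcal K=\alpha\cdot\rho+\beta$ in a neighbourhood of $Y$; 3. $d_\Sigma\mathcal K-\{\mathcal K,\mathcal K\}-d\beta\ge 0$, meaning that for all $z\in\Sigma$, $v\in T_z\Sigma$ and $w\in W$, the value of this two-form on $(v,jv)$ at $w$ is non-negative. Let $u:(\Sigma,\partial\Sigma)\to(W,Y)$ be a smooth map with $(du-X_{\mathcal K})^{0,1}=0$, where $v^{0,1}=\tfrac12(v+J\circ v\circ j)$. Then the value $$[\omega;c\theta](u)=\int_\Sigma u^*\omega-\int_{\partial\Sigma}u^*(c\,\theta)$$ of the relative de Rham class $[\omega;c\theta]\in H^2(W,Y)$ on $u$ satisfies $[\omega;c\theta](u)\ge 0$, with equality if and only if $u(\Sigma)\subset Y$. -/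

import Mathlib

open scoped Manifold ContDiff Topology

noncomputable section

namespace FloerPositivity

/-! ### Differential forms on manifolds with boundary -/

section Forms

variable {E : Type*} [NormedAddCommGroup E] [NormedSpace ℝ E]
  {H : Type*} [TopologicalSpace H] (I : ModelWithCorners ℝ E H)
  (M : Type*) [TopologicalSpace M] [ChartedSpace H M]

/-- A (not necessarily smooth) differential `k`-form on `M`. -/
abbrev DForm (k : ℕ) := ∀ x : M, TangentSpace I x [⋀^Fin k]→L[ℝ] ℝ

variable {M}

/-- The derivative at `y` of the inverse of the preferred chart around `x₀`. -/
def chartSymmDeriv (x₀ : M) (y : E) : E →L[ℝ] TangentSpace I ((extChartAt I x₀).symm y) :=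
  mfderivWithin 𝓘(ℝ, E) I (extChartAt I x₀).symm (Set.range I) y

/-- The derivative at `x` of the preferred chart around `x₀`. -/
def chartDeriv (x₀ x : M) : TangentSpace I x →L[ℝ] E :=
  mfderiv I 𝓘(ℝ, E) (extChartAt I x₀) x

/-- The expression of a form in the preferred chart around `x₀`. -/
def formInChart {k : ℕ} (η : DForm I M k) (x₀ : M) (y : E) : E [⋀^Fin k]→L[ℝ] ℝ :=
  (η ((extChartAt I x₀).symm y)).compContinuousLinearMap (chartSymmDeriv I x₀ y)

/-- A form is smooth if all its expressions in charts are (up to the boundary). -/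
def SmoothForm {k : ℕ} (η : DForm I M k) : Prop :=
  ∀ x₀ : M, ContDiffOn ℝ ∞ (formInChart I η x₀) (extChartAt I x₀).target

/-- The exterior derivative, computed at `x` in the preferred chart around `x`. -/
def extD {k : ℕ} (η : DForm I M k) : DForm I M (k + 1) := fun x =>
  (extDerivWithin (formInChart I η x) (Set.range I) (extChartAt I x x)).compContinuousLinearMap
    (chartDeriv I x x)

/-- A field of endomorphisms of the tangent spaces, expressed in the preferred chart
around `x₀`. -/
def endoInChart (A : ∀ x : M, TangentSpace I x →L[ℝ] TangentSpace I x) (x₀ : M) (y : E) :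
    E →L[ℝ] E :=
  chartDeriv I x₀ ((extChartAt I x₀).symm y) ∘L A ((extChartAt I x₀).symm y) ∘L
    chartSymmDeriv I x₀ y

/-- Symplectic forms: smooth, closed and non-degenerate `2`-forms. -/
structure IsSymplectic (Ω : DForm I M 2) : Prop where
  smooth : SmoothForm I Ω
  closed : ∀ x, extD I Ω x = 0
  nondegenerate : ∀ x (v : TangentSpace I x), (∀ w : TangentSpace I x, Ω x ![v, w] = 0) → v = 0

/-- Contact forms: smooth nowhere vanishing `1`-forms `θ` such that `dθ` is non-degenerate on
`ker θ`. -/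
structure IsContactForm (θ : DForm I M 1) : Prop where
  smooth : SmoothForm I θ
  ne_zero : ∀ x, θ x ≠ 0
  nondegenerate : ∀ x (v : TangentSpace I x), θ x ![v] = 0 →
    (∀ w : TangentSpace I x, θ x ![w] = 0 → extD I θ x ![v, w] = 0) → v = 0

/-- A smooth field `j` of endomorphisms of the tangent spaces with `j² = -1`. On a surface this
is the same as a complex structure. -/
structure IsComplexStructure (j : ∀ x : M, TangentSpace I x →L[ℝ] TangentSpace I x) : Prop where
  smooth : ∀ x₀ : M, ContDiffOn ℝ ∞ (endoInChart I j x₀) (extChartAt I x₀).target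
  sq : ∀ x (v : TangentSpace I x), j x (j x v) = -v

open Classical in
/-- The vector `X` with `Ω(X, ·) = η`, where `Ω` is a form on a single tangent space. -/
def symplecticDual {x : M} (Ω : TangentSpace I x [⋀^Fin 2]→L[ℝ] ℝ)
    (η : TangentSpace I x → ℝ) : TangentSpace I x :=
  if h : ∃ X : TangentSpace I x, ∀ w : TangentSpace I x, Ω ![X, w] = η w then h.choose else 0

/-- The Hamiltonian vector field `X_f` of a function `f`, given by `Ω(X_f, ·) = df`. -/
def hamVF (Ω : DForm I M 2) (f : M → ℝ) (x : M) : TangentSpace I x :=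
  symplecticDual I (Ω x) fun v => (mfderiv I 𝓘(ℝ, ℝ) f x v : ℝ)

/-- The Poisson bracket `{f, g} = Ω(X_f, X_g)`. -/
def poisson (Ω : DForm I M 2) (f g : M → ℝ) (x : M) : ℝ :=
  Ω x ![hamVF I Ω f x, hamVF I Ω g x]

end Forms

section Pullback

variable {E : Type*} [NormedAddCommGroup E] [NormedSpace ℝ E]
  {H : Type*} [TopologicalSpace H] (I : ModelWithCorners ℝ E H)
  {M : Type*} [TopologicalSpace M] [ChartedSpace H M]
  {E' : Type*} [NormedAddCommGroup E'] [NormedSpace ℝ E']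
  {H' : Type*} [TopologicalSpace H'] (I' : ModelWithCorners ℝ E' H')
  {M' : Type*} [TopologicalSpace M'] [ChartedSpace H' M']

/-- The pullback of a form under a map. -/
def pullback {k : ℕ} (f : M → M') (η : DForm I' M' k) : DForm I M k := fun x =>
  (η (f x)).compContinuousLinearMap (mfderiv I I' f x)

/-- The pullback of a form under a map that is defined on a subset `s`. -/
def pullbackOn {k : ℕ} (s : Set M) (f : M → M') (η : DForm I' M' k) : DForm I M k := fun x =>
  (η (f x)).compContinuousLinearMap (mfderivWithin I I' f s x)

/-- A smooth family, parametrized by `z : M`, of almost complex structures on `M'` that are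
compatible with `Ω`: `Ω(·, J_z ·)` is a Riemannian metric. -/
structure IsCompatibleFamily (Ω : DForm I' M' 2)
    (J : M → ∀ w : M', TangentSpace I' w →L[ℝ] TangentSpace I' w) : Prop where
  smooth : ∀ (z₀ : M) (w₀ : M'), ContDiffOn ℝ ∞
    (fun p : E × E' => endoInChart I' (J ((extChartAt I z₀).symm p.1)) w₀ p.2)
    ((extChartAt I z₀).target ×ˢ (extChartAt I' w₀).target)
  sq : ∀ z w (v : TangentSpace I' w), J z w (J z w v) = -v
  invariant : ∀ z w (v v' : TangentSpace I' w), Ω w ![J z w v, J z w v'] = Ω w ![v, v']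
  pos : ∀ z w (v : TangentSpace I' w), v ≠ 0 → 0 < Ω w ![v, J z w v]

variable (M M') in
/-- A one-form on `M` with values in functions on `M'`: `K z w` is the covector at `z` obtained by
evaluating the function at `w`. -/
abbrev FunForm := ∀ z : M, M' → TangentSpace I z [⋀^Fin 1]→L[ℝ] ℝ

/-- Smoothness of a function-valued one-form, as a form on `M × M'`. -/
def SmoothFunForm (K : FunForm I M M') : Prop :=
  ∀ (z₀ : M) (w₀ : M'), ContDiffOn ℝ ∞
    (fun p : E × E' => formInChart I (fun z => K z ((extChartAt I' w₀).symm p.2)) z₀ p.1)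
    ((extChartAt I z₀).target ×ˢ (extChartAt I' w₀).target)

/-- The vector-field-valued one-form `X_K`: the vector `X_K(ξ)` at `w`, for `ξ` tangent at `z`. -/
def XK (Ω : DForm I' M' 2) (K : FunForm I M M') (z : M) (w : M') (ξ : TangentSpace I z) :
    TangentSpace I' w :=
  hamVF I' Ω (fun w' => K z w' ![ξ]) w

/-- The equation `(du - X_K)^{0,1} = 0`, where `v^{0,1} = (v + J ∘ v ∘ j) / 2`. -/
def SolvesCR (Ω : DForm I' M' 2) (j : ∀ z : M, TangentSpace I z →L[ℝ] TangentSpace I z)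
    (J : M → ∀ w : M', TangentSpace I' w →L[ℝ] TangentSpace I' w) (K : FunForm I M M')
    (u : M → M') : Prop :=
  ∀ (z : M) (ξ : TangentSpace I z),
    (1 / 2 : ℝ) • ((mfderiv I I' u z ξ - XK I I' Ω K z (u z) ξ) +
      J z (u z) (mfderiv I I' u z (j z ξ) - XK I I' Ω K z (u z) (j z ξ))) = 0

/-- The value at `z : M`, `w : M'` and on the pair of vectors `ξ`, `ξ'` of the function-valued
two-form `d_M K - {K, K} - dβ`. -/
def curvatureTerm (Ω : DForm I' M' 2) (K : FunForm I M M') (β : DForm I M 1) (z : M) (w : M')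
    (ξ ξ' : TangentSpace I z) : ℝ :=
  extD I (fun z' => K z' w) z ![ξ, ξ'] -
    poisson I' Ω (fun w' => K z w' ![ξ]) (fun w' => K z w' ![ξ']) w - extD I β z ![ξ, ξ']

end Pullback

/-! ### Integration on compact oriented surfaces with boundary -/

section Integration

variable {S : Type*} [TopologicalSpace S] [ChartedSpace (EuclideanHalfSpace 2) S]
  [IsManifold (𝓡∂ 2) ∞ S] [T2Space S] [CompactSpace S]

variable (S) in
/-- A smooth partition of unity subordinate to the preferred charts. -/
def chartPartition : SmoothPartitionOfUnity S (𝓡∂ 2) S Set.univ :=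
  (SmoothPartitionOfUnity.exists_isSubordinate_chartAt_source (𝓡∂ 2) S).choose

/-- `+1` or `-1` according to whether the preferred chart around `z₀` preserves or reverses
orientations at the point with coordinates `y`, the surface being oriented by the frames
`(v, j v)`. -/
def chartSign (j : ∀ z : S, TangentSpace (𝓡∂ 2) z →L[ℝ] TangentSpace (𝓡∂ 2) z) (z₀ : S)
    (y : EuclideanSpace ℝ (Fin 2)) : ℝ :=
  (SignType.sign (endoInChart (𝓡∂ 2) j z₀ y (EuclideanSpace.single 0 1) 1) : ℝ)

/-- The integral of a `2`-form over a compact surface oriented by `j`. -/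
def surfaceIntegral (j : ∀ z : S, TangentSpace (𝓡∂ 2) z →L[ℝ] TangentSpace (𝓡∂ 2) z)
    (η : DForm (𝓡∂ 2) S 2) : ℝ :=
  ∑ᶠ i : S, ∫ y in (extChartAt (𝓡∂ 2) i).target,
    chartPartition S i ((extChartAt (𝓡∂ 2) i).symm y) * (chartSign j i y *
      formInChart (𝓡∂ 2) η i y ![EuclideanSpace.single 0 1, EuclideanSpace.single 1 1])

/-- The integral of (the restriction of) a `1`-form over the boundary of a compact surface
oriented by `j`. Charts take values in the half-plane `{y | 0 ≤ y 0}`, so in an orientation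
preserving chart the boundary orientation (outward normal first) is given by `-∂/∂y₁`. -/
def boundaryIntegral (j : ∀ z : S, TangentSpace (𝓡∂ 2) z →L[ℝ] TangentSpace (𝓡∂ 2) z)
    (η : DForm (𝓡∂ 2) S 1) : ℝ :=
  ∑ᶠ i : S, ∫ t in {t : ℝ | !₂[(0 : ℝ), t] ∈ (extChartAt (𝓡∂ 2) i).target},
    chartPartition S i ((extChartAt (𝓡∂ 2) i).symm !₂[(0 : ℝ), t]) *
      (chartSign j i !₂[(0 : ℝ), t] *
        formInChart (𝓡∂ 2) η i !₂[(0 : ℝ), t] ![-EuclideanSpace.single 1 1])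

end Integration

/-! ### Concave boundaries -/

section Concave

variable {m : ℕ}
  {W : Type*} [TopologicalSpace W] [ChartedSpace (EuclideanHalfSpace (2 * m + 2)) W]
  {Y : Type*} [TopologicalSpace Y] [ChartedSpace (EuclideanSpace ℝ (Fin (2 * m + 1))) Y]

/-- The one-form `ρ θ` on `Y × ℝ`, with `ρ` the second coordinate. -/
def liouvilleForm (θ : DForm (𝓡 (2 * m + 1)) Y 1) :
    DForm ((𝓡 (2 * m + 1)).prod 𝓘(ℝ, ℝ)) (Y × ℝ) 1 := fun p =>
  p.2 • pullback ((𝓡 (2 * m + 1)).prod 𝓘(ℝ, ℝ)) (𝓡 (2 * m + 1)) Prod.fst θ p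

/-- `(W, Ω)` has concave boundary modelled on `(Y, θ)` at level `c`: a diffeomorphism from
`Y × [c, c + ε)` onto an open neighbourhood of `∂W`, taking `Y × {c}` onto `∂W` and pulling
back `Ω` to `d(ρ θ)`. -/
structure ConcaveBoundary (Ω : DForm (𝓡∂ (2 * m + 2)) W 2) (θ : DForm (𝓡 (2 * m + 1)) Y 1)
    (c : ℝ) where
  c_pos : 0 < c
  ε : ℝ
  ε_pos : 0 < ε
  collar : PartialEquiv (Y × ℝ) W
  source_eq : collar.source = Set.univ ×ˢ Set.Ico c (c + ε)
  isOpen_target : IsOpen collar.target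
  smooth : ContMDiffOn ((𝓡 (2 * m + 1)).prod 𝓘(ℝ, ℝ)) (𝓡∂ (2 * m + 2)) ∞ collar collar.source
  smooth_symm :
    ContMDiffOn (𝓡∂ (2 * m + 2)) ((𝓡 (2 * m + 1)).prod 𝓘(ℝ, ℝ)) ∞ collar.symm collar.target
  boundary_eq : collar '' (Set.univ ×ˢ {c}) = (𝓡∂ (2 * m + 2)).boundary W
  symplectic : ∀ p ∈ collar.source,
    pullbackOn ((𝓡 (2 * m + 1)).prod 𝓘(ℝ, ℝ)) (𝓡∂ (2 * m + 2)) collar.source collar Ω p =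
      extD ((𝓡 (2 * m + 1)).prod 𝓘(ℝ, ℝ)) (liouvilleForm θ) p

namespace ConcaveBoundary

variable {Ω : DForm (𝓡∂ (2 * m + 2)) W 2} {θ : DForm (𝓡 (2 * m + 1)) Y 1} {c : ℝ}
  (B : ConcaveBoundary Ω θ c)

/-- The Liouville coordinate, meaningful on the collar. -/
def rho (w : W) : ℝ := (B.collar.symm w).2

/-- The projection to `Y`, meaningful on the collar; on `∂W` it is the identification
`∂W = Y`. -/
def proj (w : W) : Y := (B.collar.symm w).1

/-- `J` is of contact type along `∂W`: `dρ ∘ J = -ρ θ` at the points of `∂W`. -/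
def IsContactType
    (J : ∀ w : W, TangentSpace (𝓡∂ (2 * m + 2)) w →L[ℝ] TangentSpace (𝓡∂ (2 * m + 2)) w) :
    Prop :=
  ∀ w ∈ (𝓡∂ (2 * m + 2)).boundary W, ∀ v : TangentSpace (𝓡∂ (2 * m + 2)) w,
    (mfderiv (𝓡∂ (2 * m + 2)) 𝓘(ℝ, ℝ) B.rho w (J w v) : ℝ) =
      -(B.rho w * pullback (𝓡∂ (2 * m + 2)) (𝓡 (2 * m + 1)) B.proj θ w ![v])

variable {S : Type*} [TopologicalSpace S] [ChartedSpace (EuclideanHalfSpace 2) S]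
  [IsManifold (𝓡∂ 2) ∞ S] [T2Space S] [CompactSpace S]

/-- The pairing `[Ω; cθ](u) = ∫_Σ u^*Ω - ∫_{∂Σ} u^*(cθ)` of the relative de Rham class of
`(Ω, cθ)` with a map `u : (Σ, ∂Σ) → (W, ∂W)`, where `∂W` is identified with `Y`. -/
def relClass (j : ∀ z : S, TangentSpace (𝓡∂ 2) z →L[ℝ] TangentSpace (𝓡∂ 2) z) (u : S → W) : ℝ :=
  surfaceIntegral j (pullback (𝓡∂ 2) (𝓡∂ (2 * m + 2)) u Ω) -
    boundaryIntegral j (pullback (𝓡∂ 2) (𝓡 (2 * m + 1)) (B.proj ∘ u) (fun y => c • θ y))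

end ConcaveBoundary

end Concave

end FloerPositivity

end

/-!
Write `v = du - X_K`. In every tangent direction `ξ` the Cauchy-Riemann equation `v(j ξ) = J v(ξ)`
turns the energy density `Ω(v ξ, J v ξ) ≥ 0` into `(u^*Ω - d(β - K ∘ u))(ξ, j ξ)` minus the
curvature term, so by Stokes' theorem `∫ u^*Ω` is at least the integral of `β - K ∘ u` over `∂Σ`.
There `β - K ∘ u = -c α`. If `τ` is positively tangent to `∂Σ`, then `j τ` points into `Σ` and
`ρ ∘ u` has a minimum along `∂Σ`; since `J` is of contact type and `θ(X_ρ) = -1` on the collar,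
`0 ≤ d(ρ ∘ u)(j τ) = -c (u^*θ + α)(τ)`, that is, `u^*(c θ) ≤ β - K ∘ u` on `∂Σ`.

If the class evaluates to zero, the energy density vanishes, so `du = X_K`, which is a multiple of
`X_ρ` on the collar. Hence `ρ ∘ u` is locally constant near `u⁻¹(Y)`, and `u⁻¹(Y)`, being open and
closed, contains every component of `Σ` that it meets. Conversely `Ω` restricts to `d(c θ)` on `Y`.
-/

noncomputable section

namespace FloerPositivity

section AlternatingMaps

variable {R V V' N ι : Type*} [CommRing R] [AddCommGroup V] [Module R V] [TopologicalSpace V]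
  [AddCommGroup V'] [Module R V'] [TopologicalSpace V'] [AddCommGroup N] [Module R N]
  [TopologicalSpace N]

theorem compContinuousLinearMap_vecCons_one (φ : V' [⋀^Fin 1]→L[R] N) (L : V →L[R] V') (v : V) :
    φ.compContinuousLinearMap L ![v] = φ ![L v] :=
  congrArg φ (by ext i; fin_cases i; rfl)

theorem compContinuousLinearMap_vecCons_two (φ : V' [⋀^Fin 2]→L[R] N) (L : V →L[R] V') (v w : V) :
    φ.compContinuousLinearMap L ![v, w] = φ ![L v, L w] :=
  congrArg φ (by ext i; fin_cases i <;> rfl)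

variable (φ : V [⋀^Fin 2]→L[R] N)

theorem oneForm_smul (ψ : V [⋀^Fin 1]→L[R] N) (r : R) (v : V) : ψ ![r • v] = r • ψ ![v] :=
  ψ.map_vecCons_smul ![] r v

theorem oneForm_neg (ψ : V [⋀^Fin 1]→L[R] N) (v : V) : ψ ![-v] = -ψ ![v] := by
  rw [← neg_one_smul R v, oneForm_smul, neg_one_smul]

theorem oneForm_sub (ψ : V [⋀^Fin 1]→L[R] N) (v w : V) : ψ ![v - w] = ψ ![v] - ψ ![w] := by
  rw [sub_eq_add_neg, sub_eq_add_neg, ← oneForm_neg]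
  exact ψ.map_vecCons_add ![] v (-w)

theorem twoForm_self (v : V) : φ ![v, v] = 0 :=
  φ.map_eq_zero_of_eq ![v, v] (i := 0) (j := 1) rfl (by simp)

theorem twoForm_swap (v w : V) : φ ![v, w] = -φ ![w, v] :=
  .trans (congrArg φ (by ext i; fin_cases i <;> rfl))
    (φ.map_swap ![w, v] (i := 0) (j := 1) (by simp))

theorem twoForm_add_left (v v' w : V) : φ ![v + v', w] = φ ![v, w] + φ ![v', w] :=
  φ.map_vecCons_add ![w] v v'

theorem twoForm_smul_left (r : R) (v w : V) : φ ![r • v, w] = r • φ ![v, w] :=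
  φ.map_vecCons_smul ![w] r v

theorem twoForm_add_right (v w w' : V) : φ ![v, w + w'] = φ ![v, w] + φ ![v, w'] := by
  rw [twoForm_swap, twoForm_add_left, neg_add, ← twoForm_swap, ← twoForm_swap]

theorem twoForm_smul_right (r : R) (v w : V) : φ ![v, r • w] = r • φ ![v, w] := by
  rw [twoForm_swap, twoForm_smul_left, ← smul_neg, ← twoForm_swap]

theorem twoForm_sub_left (v v' w : V) : φ ![v - v', w] = φ ![v, w] - φ ![v', w] := by
  rw [eq_sub_iff_add_eq, ← twoForm_add_left, sub_add_cancel]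

theorem twoForm_sub_right (v w w' : V) : φ ![v, w - w'] = φ ![v, w] - φ ![v, w'] := by
  rw [eq_sub_iff_add_eq, ← twoForm_add_right, sub_add_cancel]

end AlternatingMaps

section Alternatization

variable {ι : Type*} [Fintype ι]
  {E : Type*} [NormedAddCommGroup E] [NormedSpace ℝ E]
  {E' : Type*} [NormedAddCommGroup E'] [NormedSpace ℝ E']
  {F : Type*} [NormedAddCommGroup F] [NormedSpace ℝ F]

theorem norm_alternatization_apply_le [DecidableEq ι]
    (f : ContinuousMultilinearMap ℝ (fun _ : ι => E) F)
    (v : ι → E) :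
    ‖ContinuousMultilinearMap.alternatization f v‖ ≤
      Fintype.card (Equiv.Perm ι) * ‖f‖ * ∏ i, ‖v i‖ := by
  rw [ContinuousMultilinearMap.alternatization_apply_apply, mul_assoc, ← nsmul_eq_mul,
    ← Finset.card_univ]
  refine (norm_sum_le _ _).trans (Finset.sum_le_card_nsmul _ _ _ fun σ _ => ?_)
  have norm_sign_smul : ‖Equiv.Perm.sign σ • f (v ∘ σ)‖ = ‖f (v ∘ σ)‖ := by
    rcases Int.units_eq_one_or (Equiv.Perm.sign σ) with hσ | hσ <;> simp [hσ]
  rw [norm_sign_smul, ← Equiv.prod_comp σ fun i => ‖v i‖]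
  exact f.le_opNorm _

variable (ι E F) in
/-- Alternatization of multilinear maps, as a continuous linear map. Up to the factor `(#ι)!` it
is a left inverse of the inclusion of alternating maps into multilinear maps, through which
smoothness questions about the former are reduced to the latter. -/
def alternatizationCLM [DecidableEq ι] :
    ContinuousMultilinearMap ℝ (fun _ : ι => E) F →L[ℝ] E [⋀^ι]→L[ℝ] F :=
  LinearMap.mkContinuous
    { toFun := fun f => ContinuousMultilinearMap.alternatization f
      map_add' := map_add _
      map_smul' := fun r f => by
        ext v
        simp [ContinuousMultilinearMap.alternatization_apply_apply, Finset.smul_sum,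
          smul_comm r] }
    (Fintype.card (Equiv.Perm ι)) fun f =>
      ContinuousAlternatingMap.opNorm_le_bound _ (by positivity)
        (norm_alternatization_apply_le f)

theorem alternatizationCLM_toContinuousMultilinearMap [DecidableEq ι] (f : E [⋀^ι]→L[ℝ] F) :
    alternatizationCLM ι E F f.toContinuousMultilinearMap =
      ((Fintype.card ι).factorial : ℝ) • f := by
  apply ContinuousAlternatingMap.toAlternatingMap_injective
  refine (ContinuousMultilinearMap.alternatization_apply_toAlternatingMap _).trans
    ((AlternatingMap.coe_alternatization f.toAlternatingMap).trans ?_)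
  ext v
  simp [Nat.cast_smul_eq_nsmul]

theorem contDiff_compContinuousLinearMap {n : WithTop ℕ∞} :
    ContDiff ℝ n fun p : (E' [⋀^ι]→L[ℝ] F) × (E →L[ℝ] E') => p.1.compContinuousLinearMap p.2 := by
  classical
  have contDiff_multilinear : ContDiff ℝ n fun p : (E' [⋀^ι]→L[ℝ] F) × (E →L[ℝ] E') =>
      ContinuousMultilinearMap.compContinuousLinearMapContinuousMultilinear ℝ
        (fun _ : ι => E) (fun _ => E') F (fun _ => p.2)
        (ContinuousAlternatingMap.toContinuousMultilinearMapCLM ℝ p.1) :=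
    ((ContinuousMultilinearMap.contDiff _).comp (contDiff_pi.2 fun _ => contDiff_snd)).clm_apply
      ((ContinuousLinearMap.contDiff _).comp contDiff_fst)
  convert! (((Fintype.card ι).factorial : ℝ)⁻¹ • alternatizationCLM ι E F).contDiff.comp
    contDiff_multilinear using 1
  funext p
  exact ((inv_smul_eq_iff₀ (by positivity)).2
    (alternatizationCLM_toContinuousMultilinearMap (p.1.compContinuousLinearMap p.2))).symm

end Alternatization

section Charts

variable {E : Type*} [NormedAddCommGroup E] [NormedSpace ℝ E]
  {H : Type*} [TopologicalSpace H] {I : ModelWithCorners ℝ E H}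
  {M : Type*} [TopologicalSpace M] [ChartedSpace H M]
  {E' : Type*} [NormedAddCommGroup E'] [NormedSpace ℝ E']
  {H' : Type*} [TopologicalSpace H'] {I' : ModelWithCorners ℝ E' H'}
  {M' : Type*} [TopologicalSpace M'] [ChartedSpace H' M']

theorem uniqueDiffWithinAt_range {y : E} {x₀ : M} (hy : y ∈ (extChartAt I x₀).target) :
    UniqueDiffWithinAt ℝ (Set.range I) y :=
  I.uniqueDiffOn y (extChartAt_target_subset_range x₀ hy)

theorem chartDeriv_self [IsManifold I 1 M] (x : M) :
    chartDeriv I x x = ContinuousLinearMap.id ℝ E :=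
  mfderiv_extChartAt_self

theorem chartDeriv_chartSymmDeriv [IsManifold I 1 M] {x₀ : M} {y : E}
    (hy : y ∈ (extChartAt I x₀).target) (v : E) :
    chartDeriv I x₀ ((extChartAt I x₀).symm y) (chartSymmDeriv I x₀ y v) = v :=
  DFunLike.congr_fun (mfderiv_extChartAt_comp_mfderivWithin_extChartAt_symm hy) v

theorem chartSymmDeriv_chartDeriv [IsManifold I 1 M] {x₀ : M} {y : E}
    (hy : y ∈ (extChartAt I x₀).target) (v : TangentSpace I ((extChartAt I x₀).symm y)) :
    chartSymmDeriv I x₀ y (chartDeriv I x₀ ((extChartAt I x₀).symm y) v) = v :=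
  DFunLike.congr_fun (mfderivWithin_extChartAt_symm_comp_mfderiv_extChartAt hy) v

theorem formInChart_apply_one {η : DForm I M 1} {x₀ : M} {y : E} (v : E) :
    formInChart I η x₀ y ![v] = η ((extChartAt I x₀).symm y) ![chartSymmDeriv I x₀ y v] :=
  compContinuousLinearMap_vecCons_one ..

theorem formInChart_apply_two {η : DForm I M 2} {x₀ : M} {y : E} (v w : E) :
    formInChart I η x₀ y ![v, w] =
      η ((extChartAt I x₀).symm y) ![chartSymmDeriv I x₀ y v, chartSymmDeriv I x₀ y w] :=
  compContinuousLinearMap_vecCons_two ..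

theorem formInChart_comp_chartDeriv [IsManifold I 1 M] {k : ℕ} (η : DForm I M k) {x₀ x : M}
    (hx : x ∈ (extChartAt I x₀).source) :
    (formInChart I η x₀ (extChartAt I x₀ x)).compContinuousLinearMap (chartDeriv I x₀ x) =
      η x := by
  obtain ⟨y, hy, rfl⟩ : ∃ y ∈ (extChartAt I x₀).target, (extChartAt I x₀).symm y = x :=
    ⟨_, (extChartAt I x₀).map_source hx, (extChartAt I x₀).left_inv hx⟩
  rw [(extChartAt I x₀).right_inv hy]
  ext v
  exact congrArg _ (funext fun i => chartSymmDeriv_chartDeriv hy (v i))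

theorem formInChart_chartDeriv_apply_two [IsManifold I 1 M] (η : DForm I M 2) {x₀ x : M}
    (hx : x ∈ (extChartAt I x₀).source) (v w : TangentSpace I x) :
    formInChart I η x₀ (extChartAt I x₀ x) ![chartDeriv I x₀ x v, chartDeriv I x₀ x w] =
      η x ![v, w] := by
  conv_rhs => rw [← formInChart_comp_chartDeriv η hx]
  exact (compContinuousLinearMap_vecCons_two ..).symm

theorem formInChart_self [IsManifold I 1 M] {k : ℕ} (η : DForm I M k) (x : M) :
    formInChart I η x (extChartAt I x x) = η x := by
  have h := formInChart_comp_chartDeriv η (mem_extChartAt_source (I := I) x)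
  rw [chartDeriv_self] at h
  exact h

variable (I I') in
/-- The map `f` written in the preferred charts around `z₀` and `w₀`, where in contrast to
`writtenInExtChartAt` the second one need not be centred at `f z₀`. -/
abbrev mapInCharts (f : M → M') (z₀ : M) (w₀ : M') : E → E' :=
  extChartAt I' w₀ ∘ f ∘ (extChartAt I z₀).symm

theorem hasFDerivWithinAt_mapInCharts [IsManifold I 1 M] [IsManifold I' 1 M'] {f : M → M'}
    {z₀ : M} {w₀ : M'} {y : E} (hy : y ∈ (extChartAt I z₀).target)
    (hf : MDifferentiableAt I I' f ((extChartAt I z₀).symm y))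
    (hw : f ((extChartAt I z₀).symm y) ∈ (extChartAt I' w₀).source) :
    HasFDerivWithinAt (mapInCharts I I' f z₀ w₀)
      (chartDeriv I' w₀ (f ((extChartAt I z₀).symm y)) ∘L
        mfderiv I I' f ((extChartAt I z₀).symm y) ∘L chartSymmDeriv I z₀ y) (Set.range I) y := by
  have hasMFDeriv_symm : HasMFDerivWithinAt 𝓘(ℝ, E) I (extChartAt I z₀).symm (Set.range I) y
      (chartSymmDeriv I z₀ y) :=
    (mdifferentiableWithinAt_extChartAt_symm hy).hasMFDerivWithinAt
  have hasMFDeriv_chart : HasMFDerivAt I' 𝓘(ℝ, E') (extChartAt I' w₀)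
      (f ((extChartAt I z₀).symm y)) (chartDeriv I' w₀ (f ((extChartAt I z₀).symm y))) :=
    (mdifferentiableAt_extChartAt (by simpa using hw)).hasMFDerivAt
  exact (hasMFDeriv_chart.comp_hasMFDerivWithinAt y
    (hf.hasMFDerivAt.comp_hasMFDerivWithinAt y hasMFDeriv_symm)).hasFDerivWithinAt

theorem contDiffWithinAt_mapInCharts {n : WithTop ℕ∞} [IsManifold I n M] [IsManifold I' n M']
    {f : M → M'} {z₀ : M} {w₀ : M'} {y : E} (hy : y ∈ (extChartAt I z₀).target)
    (hf : ContMDiffAt I I' n f ((extChartAt I z₀).symm y))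
    (hw : f ((extChartAt I z₀).symm y) ∈ (extChartAt I' w₀).source) :
    ContDiffWithinAt ℝ n (mapInCharts I I' f z₀ w₀) (Set.range I) y :=
  ((contMDiffAt_extChartAt' (by simpa using hw)).comp_contMDiffWithinAt y
    (hf.comp_contMDiffWithinAt y
      (contMDiffWithinAt_extChartAt_symm_range z₀ hy))).contDiffWithinAt

theorem target_inter_preimage_mem_nhdsWithin {X : Type*} [TopologicalSpace X] {f : M → X} {z₀ : M}
    {y : E} (hy : y ∈ (extChartAt I z₀).target) {V : Set X}
    (hf : ContinuousAt f ((extChartAt I z₀).symm y)) (hV : V ∈ 𝓝 (f ((extChartAt I z₀).symm y))) :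
    (extChartAt I z₀).target ∩ (f ∘ (extChartAt I z₀).symm) ⁻¹' V ∈ 𝓝[Set.range I] y :=
  Filter.inter_mem (extChartAt_target_mem_nhdsWithin_of_mem hy)
    (hf.comp_continuousWithinAt (continuousAt_extChartAt_symm'' hy).continuousWithinAt hV)

theorem contDiffOn_comp_extChartAt_symm {n : WithTop ℕ∞} [IsManifold I n M] {f : M → ℝ}
    (hf : ContMDiff I 𝓘(ℝ, ℝ) n f) (x₀ : M) :
    ContDiffOn ℝ n (f ∘ (extChartAt I x₀).symm) (extChartAt I x₀).target :=
  (hf.comp_contMDiffOn (contMDiffOn_extChartAt_symm x₀)).contDiffOn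

end Charts

section Pullback

variable {E : Type*} [NormedAddCommGroup E] [NormedSpace ℝ E]
  {H : Type*} [TopologicalSpace H] {I : ModelWithCorners ℝ E H}
  {M : Type*} [TopologicalSpace M] [ChartedSpace H M]
  {E' : Type*} [NormedAddCommGroup E'] [NormedSpace ℝ E']
  {H' : Type*} [TopologicalSpace H'] {I' : ModelWithCorners ℝ E' H'}
  {M' : Type*} [TopologicalSpace M'] [ChartedSpace H' M']

theorem pullback_apply_one {η : DForm I' M' 1} {f : M → M'} {x : M} (v : TangentSpace I x) :
    pullback I I' f η x ![v] = η (f x) ![mfderiv I I' f x v] :=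
  compContinuousLinearMap_vecCons_one ..

theorem pullback_apply_two {η : DForm I' M' 2} {f : M → M'} {x : M} (v w : TangentSpace I x) :
    pullback I I' f η x ![v, w] = η (f x) ![mfderiv I I' f x v, mfderiv I I' f x w] :=
  compContinuousLinearMap_vecCons_two ..

theorem pullback_id {k : ℕ} (η : DForm I M k) : pullback I I id η = η := by
  funext x
  ext v
  simp [pullback, mfderiv_id]

theorem formInChart_pullback [IsManifold I 1 M] [IsManifold I' 1 M'] {k : ℕ} (η : DForm I' M' k)
    {f : M → M'} {z₀ : M} {w₀ : M'} {y : E} (hy : y ∈ (extChartAt I z₀).target)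
    (hf : MDifferentiableAt I I' f ((extChartAt I z₀).symm y))
    (hw : f ((extChartAt I z₀).symm y) ∈ (extChartAt I' w₀).source) :
    formInChart I (pullback I I' f η) z₀ y =
      (formInChart I' η w₀ (mapInCharts I I' f z₀ w₀ y)).compContinuousLinearMap
        (fderivWithin ℝ (mapInCharts I I' f z₀ w₀) (Set.range I) y) := by
  rw [(hasFDerivWithinAt_mapInCharts hy hf hw).fderivWithin (uniqueDiffWithinAt_range hy)]
  ext v
  simp only [formInChart, pullback, ContinuousAlternatingMap.compContinuousLinearMap_apply]
  rw [← formInChart_comp_chartDeriv η hw]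
  rfl

theorem formInChart_pullback_eventuallyEq [IsManifold I ∞ M] [IsManifold I' ∞ M'] {k : ℕ}
    (η : DForm I' M' k) {f : M → M'} {U : Set M} (hU : IsOpen U) (hf : ContMDiffOn I I' ∞ f U)
    {z₀ : M} {w₀ : M'} {y : E} (hy : y ∈ (extChartAt I z₀).target)
    (hyU : (extChartAt I z₀).symm y ∈ U)
    (hw : f ((extChartAt I z₀).symm y) ∈ (extChartAt I' w₀).source) :
    ∀ᶠ y' in 𝓝[Set.range I] y, mapInCharts I I' f z₀ w₀ y' ∈ (extChartAt I' w₀).target ∧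
      formInChart I (pullback I I' f η) z₀ y' =
        (formInChart I' η w₀ (mapInCharts I I' f z₀ w₀ y')).compContinuousLinearMap
          (fderivWithin ℝ (mapInCharts I I' f z₀ w₀) (Set.range I) y') := by
  have continuousAt_f : ContinuousAt f ((extChartAt I z₀).symm y) :=
    (hf.contMDiffAt (hU.mem_nhds hyU)).continuousAt
  filter_upwards [target_inter_preimage_mem_nhdsWithin hy continuousAt_f
      (extChartAt_source_mem_nhds' hw),
    target_inter_preimage_mem_nhdsWithin hy continuousAt_id (hU.mem_nhds hyU)]
    with y' ⟨hy', hfy'⟩ ⟨_, hUy'⟩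
  exact ⟨(extChartAt I' w₀).map_source hfy', formInChart_pullback η hy'
    ((hf.contMDiffAt (hU.mem_nhds hUy')).mdifferentiableAt (by simp)) hfy'⟩

end Pullback

section SmoothForms

variable {E : Type*} [NormedAddCommGroup E] [NormedSpace ℝ E]
  {H : Type*} [TopologicalSpace H] {I : ModelWithCorners ℝ E H}
  {M : Type*} [TopologicalSpace M] [ChartedSpace H M] {k : ℕ}

theorem SmoothForm.contDiffWithinAt {η : DForm I M k} (hη : SmoothForm I η) {x₀ : M}
    {y : E} (hy : y ∈ (extChartAt I x₀).target) :
    ContDiffWithinAt ℝ ∞ (formInChart I η x₀) (Set.range I) y :=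
  (hη x₀ y hy).mono_of_mem_nhdsWithin (extChartAt_target_mem_nhdsWithin_of_mem hy)

theorem SmoothForm.differentiableWithinAt {η : DForm I M k} (hη : SmoothForm I η) {x₀ : M}
    {y : E} (hy : y ∈ (extChartAt I x₀).target) :
    DifferentiableWithinAt ℝ (formInChart I η x₀) (Set.range I) y :=
  (hη.contDiffWithinAt hy).differentiableWithinAt (by simp)

theorem SmoothForm.add {η η' : DForm I M k} (hη : SmoothForm I η) (hη' : SmoothForm I η') :
    SmoothForm I fun x => η x + η' x := fun x₀ => (hη x₀).add (hη' x₀)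

theorem SmoothForm.sub {η η' : DForm I M k} (hη : SmoothForm I η) (hη' : SmoothForm I η') :
    SmoothForm I fun x => η x - η' x := fun x₀ =>
  ((hη x₀).sub (hη' x₀)).congr fun _ _ => rfl

theorem SmoothForm.smul [IsManifold I ∞ M] {f : M → ℝ} (hf : ContMDiff I 𝓘(ℝ, ℝ) ∞ f)
    {η : DForm I M k} (hη : SmoothForm I η) : SmoothForm I fun x => f x • η x := fun x₀ =>
  (contDiffOn_comp_extChartAt_symm hf x₀).smul (hη x₀)

theorem SmoothForm.const_smul (r : ℝ) {η : DForm I M k} (hη : SmoothForm I η) :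
    SmoothForm I fun x => r • η x := fun x₀ => (hη x₀).const_smul r

theorem smoothForm_zero : SmoothForm I (0 : DForm I M k) := fun _ =>
  contDiffOn_const (c := (0 : E [⋀^Fin k]→L[ℝ] ℝ)) |>.congr fun _ _ => rfl

theorem SmoothForm.sum {ι : Type*} (s : Finset ι) {η : ι → DForm I M k}
    (hη : ∀ i ∈ s, SmoothForm I (η i)) : SmoothForm I (∑ i ∈ s, η i) :=
  Finset.sum_induction _ (SmoothForm I) (fun _ _ => .add) smoothForm_zero hη

end SmoothForms

section SmoothPullback

variable {E : Type*} [NormedAddCommGroup E] [NormedSpace ℝ E]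
  {H : Type*} [TopologicalSpace H] {I : ModelWithCorners ℝ E H}
  {M : Type*} [TopologicalSpace M] [ChartedSpace H M] [IsManifold I ∞ M]
  {E' : Type*} [NormedAddCommGroup E'] [NormedSpace ℝ E']
  {H' : Type*} [TopologicalSpace H'] {I' : ModelWithCorners ℝ E' H'}
  {M' : Type*} [TopologicalSpace M'] [ChartedSpace H' M'] [IsManifold I' ∞ M']
  {k : ℕ} {η : DForm I' M' k} (hη : SmoothForm I' η) {f : M → M'}

include hη

theorem contDiffWithinAt_formInChart_pullback {U : Set M} (hU : IsOpen U)
    (hf : ContMDiffOn I I' ∞ f U) {z₀ : M} {y : E} (hy : y ∈ (extChartAt I z₀).target)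
    (hyU : (extChartAt I z₀).symm y ∈ U) :
    ContDiffWithinAt ℝ ∞ (formInChart I (pullback I I' f η) z₀) (Set.range I) y := by
  set w₀ := f ((extChartAt I z₀).symm y)
  have hw : w₀ ∈ (extChartAt I' w₀).source := mem_extChartAt_source _
  have hy_range : y ∈ Set.range I := extChartAt_target_subset_range z₀ hy
  have eventually_eq := formInChart_pullback_eventuallyEq η hU hf hy hyU hw
  have contDiff_map : ContDiffWithinAt ℝ ∞ (mapInCharts I I' f z₀ w₀) (Set.range I) y :=
    contDiffWithinAt_mapInCharts hy (hf.contMDiffAt (hU.mem_nhds hyU)) hw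
  have contDiff_deriv : ContDiffWithinAt ℝ ∞
      (fderivWithin ℝ (mapInCharts I I' f z₀ w₀) (Set.range I)) (Set.range I) y :=
    contDiff_map.fderivWithin_right I.uniqueDiffOn (by simp) hy_range
  have contDiff_form : ContDiffWithinAt ℝ ∞
      (formInChart I' η w₀ ∘ mapInCharts I I' f z₀ w₀) (Set.range I) y :=
    ContDiffWithinAt.comp_of_preimage_mem_nhdsWithin y
      (hη w₀ _ ((extChartAt I' w₀).map_source hw)) contDiff_map
      (eventually_eq.mono fun _ h => h.1)
  exact (contDiff_compContinuousLinearMap.contDiffAt.comp_contDiffWithinAt y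
    (contDiff_form.prodMk contDiff_deriv)).congr_of_eventuallyEq
      (eventually_eq.mono fun _ h => h.2) (eventually_eq.self_of_nhdsWithin hy_range).2

theorem SmoothForm.pullback (hf : ContMDiff I I' ∞ f) :
    SmoothForm I (FloerPositivity.pullback I I' f η) := fun z₀ _ hy =>
  (contDiffWithinAt_formInChart_pullback hη isOpen_univ hf.contMDiffOn hy
    (Set.mem_univ _)).mono (extChartAt_target_subset_range z₀)

end SmoothPullback

section ExteriorDerivativeWithin

variable {E : Type*} [NormedAddCommGroup E] [NormedSpace ℝ E]
  {E' : Type*} [NormedAddCommGroup E'] [NormedSpace ℝ E']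
  {F : Type*} [NormedAddCommGroup F] [NormedSpace ℝ F]

theorem extDerivWithin_inter {k : ℕ} {ζ : E → E [⋀^Fin k]→L[ℝ] F} {s t : Set E} {y : E}
    (ht : t ∈ 𝓝 y) : extDerivWithin ζ (s ∩ t) y = extDerivWithin ζ s y := by
  rw [extDerivWithin, extDerivWithin, fderivWithin_inter ht]

theorem extDerivWithin_oneForm_apply (ζ : E → E [⋀^Fin 1]→L[ℝ] F) (s : Set E) (y v w : E) :
    extDerivWithin ζ s y ![v, w] =
      fderivWithin ℝ ζ s y v ![w] - fderivWithin ℝ ζ s y w ![v] := by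
  have removeNth_zero : Fin.removeNth 0 ![v, w] = ![w] := by ext i; fin_cases i; rfl
  have removeNth_one : Fin.removeNth 1 ![v, w] = ![v] := by ext i; fin_cases i; rfl
  rw [extDerivWithin, ContinuousAlternatingMap.alternatizeUncurryFin_apply, Fin.sum_univ_two,
    removeNth_zero, removeNth_one]
  simp [sub_eq_add_neg]

theorem extDerivWithin_smul_oneForm_apply {g : E → ℝ} {ζ : E → E [⋀^Fin 1]→L[ℝ] F} {s : Set E}
    {y : E} (hs : UniqueDiffWithinAt ℝ s y) (hg : DifferentiableWithinAt ℝ g s y)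
    (hζ : DifferentiableWithinAt ℝ ζ s y) (v w : E) :
    extDerivWithin (fun y => g y • ζ y) s y ![v, w] =
      fderivWithin ℝ g s y v • ζ y ![w] - fderivWithin ℝ g s y w • ζ y ![v] +
        g y • extDerivWithin ζ s y ![v, w] := by
  rw [extDerivWithin_oneForm_apply, extDerivWithin_oneForm_apply, fderivWithin_fun_smul hs hg hζ]
  simp only [add_apply, smul_apply, ContinuousLinearMap.smulRight_apply,
    ContinuousAlternatingMap.add_apply, ContinuousAlternatingMap.smul_apply]
  module

theorem extDerivWithin_pullback_of_eventually_mem {k : ℕ} {ζ : E' → E' [⋀^Fin k]→L[ℝ] F}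
    {f : E → E'} {s : Set E} {t : Set E'} {y : E} (hζ : DifferentiableWithinAt ℝ ζ t (f y))
    (hf : ContDiffWithinAt ℝ 2 f s y) (hs : UniqueDiffOn ℝ s) (hy : y ∈ s)
    (hy_closure : y ∈ closure (interior s)) (hft : ∀ᶠ y' in 𝓝[s] y, f y' ∈ t) :
    extDerivWithin (fun y' => (ζ (f y')).compContinuousLinearMap (fderivWithin ℝ f s y')) s y =
      (extDerivWithin ζ t (f y)).compContinuousLinearMap (fderivWithin ℝ f s y) := by
  obtain ⟨O, hO, hyO, hOt⟩ := mem_nhdsWithin.1 hft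
  have fderivWithin_eq : ∀ y' ∈ O, fderivWithin ℝ f (s ∩ O) y' = fderivWithin ℝ f s y' :=
    fun y' hy' => fderivWithin_inter (hO.mem_nhds hy')
  rw [← extDerivWithin_inter (hO.mem_nhds hyO), ← fderivWithin_eq y hyO,
    ← extDerivWithin_pullback hζ (hf.mono Set.inter_subset_left)
      (minSmoothness_of_isRCLikeNormedField.le) (hs.inter hO) ?_ ⟨hy, hyO⟩
      fun y' hy' => hOt hy'.symm]
  · exact extDerivWithin_congr' (fun y' hy' => by rw [fderivWithin_eq y' hy'.2]) ⟨hy, hyO⟩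
  · rw [interior_inter, hO.interior_eq]
    exact hO.closure_inter ⟨hy_closure, hyO⟩

end ExteriorDerivativeWithin

section ExteriorDerivative

variable {E : Type*} [NormedAddCommGroup E] [NormedSpace ℝ E]
  {H : Type*} [TopologicalSpace H] {I : ModelWithCorners ℝ E H}
  {M : Type*} [TopologicalSpace M] [ChartedSpace H M]
  {E' : Type*} [NormedAddCommGroup E'] [NormedSpace ℝ E']
  {H' : Type*} [TopologicalSpace H'] {I' : ModelWithCorners ℝ E' H'}
  {M' : Type*} [TopologicalSpace M'] [ChartedSpace H' M'] {k : ℕ}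

theorem extD_eq_extDerivWithin [IsManifold I 1 M] (η : DForm I M k) (x : M) :
    extD I η x = extDerivWithin (formInChart I η x) (Set.range I) (extChartAt I x x) := by
  rw [extD, chartDeriv_self]
  rfl

theorem formInChart_pullback_extD [IsManifold I ∞ M] [IsManifold I' ∞ M'] {η : DForm I' M' k}
    (hη : SmoothForm I' η) {f : M → M'} {U : Set M} (hU : IsOpen U) (hf : ContMDiffOn I I' ∞ f U)
    {z₀ : M} {y : E} (hy : y ∈ (extChartAt I z₀).target) (hyU : (extChartAt I z₀).symm y ∈ U) :
    formInChart I (pullback I I' f (extD I' η)) z₀ y =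
      extDerivWithin (formInChart I (pullback I I' f η) z₀) (Set.range I) y := by
  set w₀ := f ((extChartAt I z₀).symm y)
  have hw : w₀ ∈ (extChartAt I' w₀).source := mem_extChartAt_source _
  have hy_range : y ∈ Set.range I := extChartAt_target_subset_range z₀ hy
  have contMDiffAt_f := hf.contMDiffAt (hU.mem_nhds hyU)
  have eventually_eq := formInChart_pullback_eventuallyEq η hU hf hy hyU hw
  have extDerivWithin_eq := extDerivWithin_pullback_of_eventually_mem
    (f := mapInCharts I I' f z₀ w₀) (hη.differentiableWithinAt ((extChartAt I' w₀).map_source hw))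
    ((contDiffWithinAt_mapInCharts (n := ∞) hy contMDiffAt_f hw).of_le
      (WithTop.coe_le_coe.2 le_top)) I.uniqueDiffOn hy_range
    (I.range_subset_closure_interior hy_range)
    (eventually_eq.mono fun y' h => extChartAt_target_subset_range w₀ h.1)
  rw [formInChart_pullback _ hy (contMDiffAt_f.mdifferentiableAt (by simp)) hw,
    Filter.EventuallyEq.extDerivWithin_eq_of_mem (eventually_eq.mono fun _ h => h.2) hy_range,
    extDerivWithin_eq]
  exact congrArg (·.compContinuousLinearMap
    (fderivWithin ℝ (mapInCharts I I' f z₀ w₀) (Set.range I) y))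
    ((formInChart_self _ w₀).trans (extD_eq_extDerivWithin η w₀))

theorem formInChart_extD [IsManifold I ∞ M] {η : DForm I M k} (hη : SmoothForm I η)
    {z₀ : M} {y : E} (hy : y ∈ (extChartAt I z₀).target) :
    formInChart I (extD I η) z₀ y = extDerivWithin (formInChart I η z₀) (Set.range I) y := by
  simpa only [pullback_id] using
    formInChart_pullback_extD hη isOpen_univ contMDiff_id.contMDiffOn hy (Set.mem_univ _)

theorem extD_pullback [IsManifold I ∞ M] [IsManifold I' ∞ M'] {η : DForm I' M' k}
    (hη : SmoothForm I' η) {f : M → M'} (hf : ContMDiff I I' ∞ f) :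
    extD I (pullback I I' f η) = pullback I I' f (extD I' η) := by
  funext z
  rw [extD_eq_extDerivWithin, ← formInChart_self (pullback I I' f (extD I' η)),
    formInChart_pullback_extD hη isOpen_univ hf.contMDiffOn (mem_extChartAt_target z)
      (Set.mem_univ _)]

theorem SmoothForm.extD [IsManifold I ∞ M] {η : DForm I M k} (hη : SmoothForm I η) :
    SmoothForm I (extD I η) := by
  intro z₀ y hy
  have contDiff_extDerivWithin : ContDiffWithinAt ℝ ∞
      (extDerivWithin (formInChart I η z₀) (Set.range I)) (Set.range I) y :=
    (ContinuousAlternatingMap.alternatizeUncurryFinCLM ℝ E ℝ).contDiff.comp_contDiffWithinAt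
      ((hη.contDiffWithinAt hy).fderivWithin_right I.uniqueDiffOn (by simp)
        (extChartAt_target_subset_range z₀ hy))
  exact (contDiff_extDerivWithin.mono (extChartAt_target_subset_range z₀)).congr
    (fun y' hy' => formInChart_extD hη hy') (formInChart_extD hη hy)

theorem extD_zero : extD I (0 : DForm I M k) = 0 := by
  funext x
  have formInChart_zero : formInChart I (0 : DForm I M k) x = fun _ => 0 := rfl
  ext v
  rw [extD, formInChart_zero, extDerivWithin, fderivWithin_fun_const]
  exact DFunLike.congr_fun (map_zero (ContinuousAlternatingMap.alternatizeUncurryFinCLM ℝ E ℝ)) _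

theorem extD_add {η η' : DForm I M k} (hη : SmoothForm I η) (hη' : SmoothForm I η') :
    extD I (fun x => η x + η' x) = fun x => extD I η x + extD I η' x := by
  funext x
  have hx := mem_extChartAt_target (I := I) x
  ext v
  exact DFunLike.congr_fun (extDerivWithin_add (uniqueDiffWithinAt_range hx)
    (hη.differentiableWithinAt hx) (hη'.differentiableWithinAt hx)) _

theorem extD_sub {η η' : DForm I M k} (hη : SmoothForm I η) (hη' : SmoothForm I η') :
    extD I (fun x => η x - η' x) = fun x => extD I η x - extD I η' x := by
  refine funext fun x => eq_sub_of_add_eq ?_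
  have h := congrFun (extD_add (hη.sub hη') hη') x
  simpa only [sub_add_cancel] using h.symm

theorem extD_sum {ι : Type*} (s : Finset ι) {η : ι → DForm I M k}
    (hη : ∀ i ∈ s, SmoothForm I (η i)) : extD I (∑ i ∈ s, η i) = ∑ i ∈ s, extD I (η i) := by
  induction s using Finset.cons_induction with
  | empty => exact extD_zero
  | cons a s ha ih =>
    have hη_s : ∀ i ∈ s, SmoothForm I (η i) := fun i hi => hη i (Finset.mem_cons_of_mem hi)
    rw [Finset.sum_cons, Finset.sum_cons, ← ih hη_s]
    exact extD_add (hη a (Finset.mem_cons_self a s)) (SmoothForm.sum s hη_s)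

variable (I) in
/-- The differential of a real function. Unlike `mfderiv`, it takes its values in `ℝ` rather than
in a tangent space of `ℝ`, so that they can be multiplied. -/
def differential (f : M → ℝ) (x : M) : TangentSpace I x →L[ℝ] ℝ := mfderiv I 𝓘(ℝ, ℝ) f x

theorem differential_eq_fderivWithin {f : M → ℝ} {x : M} (hf : MDifferentiableAt I 𝓘(ℝ, ℝ) f x) :
    differential I f x =
      fderivWithin ℝ (f ∘ (extChartAt I x).symm) (Set.range I) (extChartAt I x x) :=
  hf.mfderiv

theorem extD_smul_apply [IsManifold I 1 M] {f : M → ℝ} {x : M}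
    (hf : MDifferentiableAt I 𝓘(ℝ, ℝ) f x) {η : DForm I M 1} (hη : SmoothForm I η)
    (v w : TangentSpace I x) :
    extD I (fun x => f x • η x) x ![v, w] =
      differential I f x v * η x ![w] - differential I f x w * η x ![v] +
        f x * extD I η x ![v, w] := by
  have hx := mem_extChartAt_target (I := I) x
  have f_comp_symm : (f ∘ (extChartAt I x).symm) (extChartAt I x x) = f x := by simp
  rw [extD_eq_extDerivWithin, extD_eq_extDerivWithin, ← formInChart_self η x,
    differential_eq_fderivWithin hf, ← f_comp_symm]
  exact extDerivWithin_smul_oneForm_apply (uniqueDiffWithinAt_range hx)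
    hf.differentiableWithinAt_writtenInExtChartAt (hη.differentiableWithinAt hx) v w

end ExteriorDerivative

local notation "ℝ²" => EuclideanSpace ℝ (Fin 2)
local notation "e₀" => EuclideanSpace.single (0 : Fin 2) (1 : ℝ)
local notation "e₁" => EuclideanSpace.single (1 : Fin 2) (1 : ℝ)

section PlaneAlgebra

theorem euclidean_two_eq (v : ℝ²) : v = v 0 • e₀ + v 1 • e₁ := by
  ext i
  fin_cases i <;> simp

theorem twoForm_apply_plane (φ : ℝ² [⋀^Fin 2]→L[ℝ] ℝ) (v w : ℝ²) :
    φ ![v, w] = (v 0 * w 1 - v 1 * w 0) * φ ![e₀, e₁] := by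
  conv_lhs => rw [euclidean_two_eq v, euclidean_two_eq w]
  simp only [twoForm_add_left, twoForm_smul_left, twoForm_add_right, twoForm_smul_right,
    twoForm_self, twoForm_swap φ e₁ e₀, smul_eq_mul]
  ring

theorem det_plane (L : ℝ² →L[ℝ] ℝ²) : L.det = L e₀ 0 * L e₁ 1 - L e₀ 1 * L e₁ 0 := by
  rw [ContinuousLinearMap.det,
    ← LinearMap.det_toMatrix (EuclideanSpace.basisFun (Fin 2) ℝ).toBasis, Matrix.det_fin_two]
  simp only [LinearMap.toMatrix_apply, OrthonormalBasis.coe_toBasis,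
    OrthonormalBasis.coe_toBasis_repr_apply, EuclideanSpace.basisFun_apply,
    EuclideanSpace.basisFun_repr, ContinuousLinearMap.coe_coe]
  ring

theorem apply_plane (A : ℝ² →L[ℝ] ℝ²) (v : ℝ²) (i : Fin 2) :
    A v i = v 0 * A e₀ i + v 1 * A e₁ i := by
  conv_lhs => rw [euclidean_two_eq v]
  simp

variable {A : ℝ² →L[ℝ] ℝ²}

theorem complexStructure_plane_sq_add (hA : ∀ v, A (A v) = -v) :
    A e₀ 0 ^ 2 + A e₀ 1 * A e₁ 0 = -1 := by
  have first_coord : A (A e₀) 0 = -1 := by simp [hA]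
  rw [apply_plane A (A e₀)] at first_coord
  linarith

theorem complexStructure_plane_ne_zero (hA : ∀ v, A (A v) = -v) : A e₀ 1 ≠ 0 := by
  intro h
  have sq_add := complexStructure_plane_sq_add hA
  rw [h] at sq_add
  nlinarith [sq_nonneg (A e₀ 0)]

theorem complexStructure_plane_trace (hA : ∀ v, A (A v) = -v) : A e₁ 1 = -A e₀ 0 := by
  have second_coord : A (A e₀) 1 = 0 := by simp [hA]
  rw [apply_plane A (A e₀)] at second_coord
  exact mul_left_cancel₀ (complexStructure_plane_ne_zero hA) (by linarith)

theorem complexStructure_plane_pos (hA : ∀ v, A (A v) = -v) {v : ℝ²} (hv : v ≠ 0) :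
    0 < A e₀ 1 * (v 0 * A v 1 - v 1 * A v 0) := by
  have sum_sq : A e₀ 1 * (v 0 * A v 1 - v 1 * A v 0) =
      (A e₀ 1 * v 0 - A e₀ 0 * v 1) ^ 2 + v 1 ^ 2 := by
    rw [apply_plane A v 0, apply_plane A v 1, complexStructure_plane_trace hA]
    linear_combination (-(v 1) ^ 2) * complexStructure_plane_sq_add hA
  rw [sum_sq]
  by_cases h₁ : v 1 = 0
  · have h₀ : v 0 ≠ 0 := fun h₀ => hv <| by
      rw [euclidean_two_eq v, h₀, h₁, zero_smul, zero_smul, add_zero]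
    have := sq_pos_of_ne_zero (mul_ne_zero (complexStructure_plane_ne_zero hA) h₀)
    rw [h₁, mul_zero, sub_zero]
    positivity
  · positivity

theorem det_mul_pos_of_semiconj {A' L : ℝ² →L[ℝ] ℝ²} (hA' : ∀ v, A' (A' v) = -v)
    (hL : Function.Injective L) (hLA : ∀ v, A' (L v) = L (A v)) :
    0 < A e₀ 1 * A' e₀ 1 * L.det := by
  have hLe₀ : L e₀ ≠ 0 := (map_ne_zero_iff L hL).2 (by simp)
  have pos := complexStructure_plane_pos hA' hLe₀
  rw [hLA, apply_plane L (A e₀) 0, apply_plane L (A e₀) 1] at pos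
  rw [det_plane]
  linarith

end PlaneAlgebra

section Charts

variable {E : Type*} [NormedAddCommGroup E] [NormedSpace ℝ E]
  {H : Type*} [TopologicalSpace H] {I : ModelWithCorners ℝ E H}
  {M : Type*} [TopologicalSpace M] [ChartedSpace H M] {i k : M} {y : E}

theorem chartDeriv_injective [IsManifold I 1 M] {x : M} (hx : x ∈ (extChartAt I i).source) :
    Function.Injective (chartDeriv I i x) :=
  (isInvertible_mfderiv_extChartAt hx).injective

theorem chartSymmDeriv_injective [IsManifold I 1 M] (hy : y ∈ (extChartAt I i).target) :
    Function.Injective (chartSymmDeriv I i y) :=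
  Function.LeftInverse.injective (chartDeriv_chartSymmDeriv hy)

theorem chartSymmDeriv_endoInChart [IsManifold I 1 M]
    {A : ∀ x : M, TangentSpace I x →L[ℝ] TangentSpace I x} (hy : y ∈ (extChartAt I i).target)
    (v : E) :
    chartSymmDeriv I i y (endoInChart I A i y v) = A _ (chartSymmDeriv I i y v) :=
  chartSymmDeriv_chartDeriv hy _

theorem endoInChart_chartDeriv [IsManifold I 1 M]
    {A : ∀ x : M, TangentSpace I x →L[ℝ] TangentSpace I x} {x : M}
    (hx : x ∈ (extChartAt I i).source) (v : TangentSpace I x) :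
    endoInChart I A i (extChartAt I i x) (chartDeriv I i x v) = chartDeriv I i x (A x v) := by
  obtain ⟨y, hy, rfl⟩ : ∃ y ∈ (extChartAt I i).target, (extChartAt I i).symm y = x :=
    ⟨_, (extChartAt I i).map_source hx, (extChartAt I i).left_inv hx⟩
  rw [(extChartAt I i).right_inv hy]
  change chartDeriv I i _ (A _ (chartSymmDeriv I i y _)) = _
  rw [chartSymmDeriv_chartDeriv hy]

theorem IsComplexStructure.endoInChart_sq [IsManifold I 1 M]
    {j : ∀ x : M, TangentSpace I x →L[ℝ] TangentSpace I x} (hj : IsComplexStructure I j)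
    (hy : y ∈ (extChartAt I i).target) (v : E) :
    endoInChart I j i y (endoInChart I j i y v) = -v := by
  apply chartSymmDeriv_injective hy
  rw [chartSymmDeriv_endoInChart hy, chartSymmDeriv_endoInChart hy, hj.sq, map_neg]

theorem formInChart_eq_zero {n : ℕ} {η : DForm I M n} (h : η ((extChartAt I i).symm y) = 0) :
    formInChart I η i y = 0 := by
  rw [formInChart, h]
  rfl

theorem extD_eq_zero_of_eventuallyEq {n : ℕ} {η : DForm I M n} {x : M}
    (h : ∀ᶠ x' in 𝓝 x, η x' = 0) : extD I η x = 0 := by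
  have eventually_zero : ∀ᶠ y in 𝓝 (extChartAt I x x), η ((extChartAt I x).symm y) = 0 :=
    (continuousAt_extChartAt_symm (I := I) x).eventually (by rwa [extChartAt_to_inv])
  have eventuallyEq : formInChart I η x =ᶠ[𝓝 (extChartAt I x x)]
      formInChart I (0 : DForm I M n) x :=
    eventually_zero.mono fun y hy => by rw [formInChart_eq_zero hy, formInChart_eq_zero rfl]
  have extD_eq : extD I η x = extD I (0 : DForm I M n) x := by
    rw [extD, extD, eventuallyEq.extDerivWithin_eq_nhds]
  rw [extD_eq, extD_zero]
  rfl

theorem isCompact_image_extChartAt {C : Set M} (hC : IsCompact C)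
    (hCi : C ⊆ (extChartAt I i).source) : IsCompact (extChartAt I i '' C) :=
  hC.image_of_continuousOn ((continuousOn_extChartAt i).mono hCi)

theorem symm_notMem_of_notMem_image {C : Set M} (hy : y ∈ (extChartAt I i).target)
    (hyC : y ∉ extChartAt I i '' C) : (extChartAt I i).symm y ∉ C := fun h =>
  hyC ⟨_, h, (extChartAt I i).right_inv hy⟩

theorem hasFDerivWithinAt_extChartAt_trans [IsManifold I 1 M]
    (hy : y ∈ ((extChartAt I i).symm ≫ extChartAt I k).source) :
    HasFDerivWithinAt ((extChartAt I i).symm ≫ extChartAt I k)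
      (chartDeriv I k ((extChartAt I i).symm y) ∘L chartSymmDeriv I i y)
      ((extChartAt I i).symm ≫ extChartAt I k).source y := by
  have deriv := hasFDerivWithinAt_mapInCharts (I' := I) (f := (id : M → M)) hy.1
    mdifferentiableAt_id hy.2
  rw [mfderiv_id] at deriv
  exact deriv.mono (Set.inter_subset_left.trans (extChartAt_target_subset_range i))

section Measurable

variable [MeasurableSpace E] [OpensMeasurableSpace E]

theorem measurableSet_extChartAt_target (i : M) : MeasurableSet (extChartAt I i).target := by
  rw [extChartAt_target]
  exact ((chartAt H i).open_target.preimage I.continuous_symm).measurableSet.inter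
    I.isClosed_range.measurableSet

theorem measurableSet_extChartAt_trans_source (i k : M) :
    MeasurableSet ((extChartAt I i).symm ≫ extChartAt I k).source := by
  obtain ⟨O, hO, preimage_eq⟩ := continuousOn_iff'.1 (continuousOn_extChartAt_symm (I := I) i) _
    (isOpen_extChartAt_source (I := I) k)
  rw [PartialEquiv.trans_source, PartialEquiv.symm_source, Set.inter_comm, preimage_eq]
  exact hO.measurableSet.inter (measurableSet_extChartAt_target i)

end Measurable

end Charts

section ChartIntegral

variable {S : Type*} [TopologicalSpace S] [ChartedSpace (EuclideanHalfSpace 2) S]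
  {j : ∀ z : S, TangentSpace (𝓡∂ 2) z →L[ℝ] TangentSpace (𝓡∂ 2) z}

/-- The coefficient of a `2`-form in the chart around `i`, relative to the area form of the
coordinates oriented by `j`. -/
def chartDensity (j : ∀ z : S, TangentSpace (𝓡∂ 2) z →L[ℝ] TangentSpace (𝓡∂ 2) z) (i : S)
    (η : DForm (𝓡∂ 2) S 2) (y : ℝ²) : ℝ :=
  chartSign j i y * formInChart (𝓡∂ 2) η i y ![e₀, e₁]

/-- The integral of a `2`-form over the domain of the chart around `i`, oriented by `j`. -/
def chartIntegral (j : ∀ z : S, TangentSpace (𝓡∂ 2) z →L[ℝ] TangentSpace (𝓡∂ 2) z) (i : S)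
    (η : DForm (𝓡∂ 2) S 2) : ℝ :=
  ∫ y in (extChartAt (𝓡∂ 2) i).target, chartDensity j i η y

theorem chartDensity_eq_zero {η : DForm (𝓡∂ 2) S 2} {i : S} {y : ℝ²}
    (h : η ((extChartAt (𝓡∂ 2) i).symm y) = 0) : chartDensity j i η y = 0 := by
  rw [chartDensity, formInChart_eq_zero h, ContinuousAlternatingMap.coe_zero, Pi.zero_apply,
    mul_zero]

theorem chartDensity_sum {ι : Type*} (s : Finset ι) (η : ι → DForm (𝓡∂ 2) S 2) (i : S) (y : ℝ²) :
    chartDensity j i (∑ a ∈ s, η a) y = ∑ a ∈ s, chartDensity j i (η a) y := by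
  simp only [chartDensity, formInChart, Finset.sum_apply, Finset.mul_sum,
    ContinuousAlternatingMap.compContinuousLinearMap_apply, ContinuousAlternatingMap.sum_apply]

theorem chartIntegral_sum (i : S) {ι : Type*} (s : Finset ι) (η : ι → DForm (𝓡∂ 2) S 2)
    (hη : ∀ a ∈ s, MeasureTheory.IntegrableOn (chartDensity j i (η a))
      (extChartAt (𝓡∂ 2) i).target) :
    chartIntegral j i (∑ a ∈ s, η a) = ∑ a ∈ s, chartIntegral j i (η a) := by
  simp only [chartIntegral, chartDensity_sum]
  exact MeasureTheory.integral_finsetSum _ hη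

theorem chartIntegral_eq_setIntegral_overlap {η : DForm (𝓡∂ 2) S 2} {i k : S}
    (hk : ∀ z ∉ (extChartAt (𝓡∂ 2) k).source, η z = 0) :
    chartIntegral j i η =
      ∫ y in ((extChartAt (𝓡∂ 2) i).symm ≫ extChartAt (𝓡∂ 2) k).source, chartDensity j i η y :=
  MeasureTheory.setIntegral_eq_of_subset_of_forall_sdiff_eq_zero
    (measurableSet_extChartAt_target i) Set.inter_subset_left
    fun _ hy => chartDensity_eq_zero (hk _ fun h => hy.2 ⟨hy.1, h⟩)

variable [IsManifold (𝓡∂ 2) ∞ S]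

theorem endoInChart_e₀_ne_zero (hj : IsComplexStructure (𝓡∂ 2) j) {i : S} {y : ℝ²}
    (hy : y ∈ (extChartAt (𝓡∂ 2) i).target) : endoInChart (𝓡∂ 2) j i y e₀ 1 ≠ 0 :=
  complexStructure_plane_ne_zero (hj.endoInChart_sq hy)

theorem chartSign_eq_or (hj : IsComplexStructure (𝓡∂ 2) j) {i : S} {y : ℝ²}
    (hy : y ∈ (extChartAt (𝓡∂ 2) i).target) : chartSign j i y = 1 ∨ chartSign j i y = -1 := by
  rcases (endoInChart_e₀_ne_zero hj hy).lt_or_gt with h | h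
  · exact .inr (by rw [chartSign, sign_neg h, SignType.coe_neg_one])
  · exact .inl (by rw [chartSign, sign_pos h, SignType.coe_one])

theorem chartSign_eventuallyEq (hj : IsComplexStructure (𝓡∂ 2) j) {i : S} {y : ℝ²}
    (hy : y ∈ (extChartAt (𝓡∂ 2) i).target) :
    ∀ᶠ y' in 𝓝[(extChartAt (𝓡∂ 2) i).target] y, chartSign j i y' = chartSign j i y := by
  have continuous_entry : ContinuousWithinAt (fun y' => endoInChart (𝓡∂ 2) j i y' e₀ 1)
      (extChartAt (𝓡∂ 2) i).target y :=
    (EuclideanSpace.proj (𝕜 := ℝ) (1 : Fin 2)).continuous.continuousAt.comp_continuousWithinAt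
      (((hj.smooth i).continuousOn y hy).clm_apply continuousWithinAt_const)
  rcases (endoInChart_e₀_ne_zero hj hy).lt_or_gt with h | h
  · filter_upwards [continuous_entry.eventually_lt_const h] with y' hy'
    rw [chartSign, chartSign, sign_neg h, sign_neg hy']
  · filter_upwards [continuous_entry.eventually_const_lt h] with y' hy'
    rw [chartSign, chartSign, sign_pos h, sign_pos hy']

theorem continuousOn_chartSign (hj : IsComplexStructure (𝓡∂ 2) j) (i : S) :
    ContinuousOn (chartSign j i) (extChartAt (𝓡∂ 2) i).target := fun _ hy =>
  continuousWithinAt_const.congr_of_eventuallyEq (chartSign_eventuallyEq hj hy) rfl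

theorem continuousOn_chartDensity (hj : IsComplexStructure (𝓡∂ 2) j) {η : DForm (𝓡∂ 2) S 2}
    (hη : SmoothForm (𝓡∂ 2) η) (i : S) :
    ContinuousOn (chartDensity j i η) (extChartAt (𝓡∂ 2) i).target :=
  (continuousOn_chartSign hj i).mul <|
    (ContinuousAlternatingMap.apply ℝ ℝ² ℝ _).continuous.comp_continuousOn (hη i).continuousOn

theorem integrableOn_chartDensity (hj : IsComplexStructure (𝓡∂ 2) j) {η : DForm (𝓡∂ 2) S 2}
    (hη : SmoothForm (𝓡∂ 2) η) {i : S} {C : Set S} (hC : IsCompact C)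
    (hCi : C ⊆ (extChartAt (𝓡∂ 2) i).source) (hηC : ∀ z ∉ C, η z = 0) :
    MeasureTheory.IntegrableOn (chartDensity j i η) (extChartAt (𝓡∂ 2) i).target := by
  have image_subset : extChartAt (𝓡∂ 2) i '' C ⊆ (extChartAt (𝓡∂ 2) i).target :=
    (Set.image_mono hCi).trans (extChartAt (𝓡∂ 2) i).image_source_eq_target.subset
  exact .of_forall_sdiff_eq_zero
    (((continuousOn_chartDensity hj hη i).mono image_subset).integrableOn_compact
      (isCompact_image_extChartAt hC hCi)) (measurableSet_extChartAt_target i)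
    fun y hy => chartDensity_eq_zero (hηC _ (symm_notMem_of_notMem_image hy.1 hy.2))

theorem chartDensity_nonneg (hj : IsComplexStructure (𝓡∂ 2) j) {η : DForm (𝓡∂ 2) S 2} {i : S}
    {y : ℝ²} (hy : y ∈ (extChartAt (𝓡∂ 2) i).target)
    (hη : ∀ ξ, 0 ≤ η ((extChartAt (𝓡∂ 2) i).symm y) ![ξ, j _ ξ]) : 0 ≤ chartDensity j i η y := by
  have nonneg_e₀ := hη (chartSymmDeriv (𝓡∂ 2) i y e₀)
  rw [← chartSymmDeriv_endoInChart hy, ← formInChart_apply_two, twoForm_apply_plane,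
    show (e₀ : ℝ²) 0 = 1 by simp, show (e₀ : ℝ²) 1 = 0 by simp, one_mul, zero_mul,
    sub_zero] at nonneg_e₀
  rw [chartDensity, chartSign]
  rcases (endoInChart_e₀_ne_zero hj hy).lt_or_gt with h | h
  · rw [sign_neg h, SignType.coe_neg_one]
    linarith [nonpos_of_mul_nonneg_right nonneg_e₀ h]
  · rw [sign_pos h, SignType.coe_one, one_mul]
    exact nonneg_of_mul_nonneg_right nonneg_e₀ h

theorem sign_mul_eq_abs_mul_sign {a b d : ℝ} (h : 0 < a * b * d) :
    (SignType.sign a : ℝ) * d = |d| * (SignType.sign b : ℝ) := by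
  have sign_eq_one : (SignType.sign a : ℝ) * SignType.sign b * SignType.sign d = 1 := by
    rw [← SignType.coe_mul, ← SignType.coe_mul, ← sign_mul, ← sign_mul, sign_pos h,
      SignType.coe_one]
  have sign_sq : (SignType.sign b : ℝ) * SignType.sign b = 1 := by
    have : b ≠ 0 := right_ne_zero_of_mul (left_ne_zero_of_mul h.ne')
    rw [← SignType.coe_mul, ← sign_mul, sign_pos (mul_self_pos.2 this), SignType.coe_one]
  calc (SignType.sign a : ℝ) * d
      = SignType.sign a * (SignType.sign d * |d|) * (SignType.sign b * SignType.sign b) := by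
        rw [sign_sq, sign_mul_abs, mul_one]
    _ = |d| * SignType.sign b * (SignType.sign a * SignType.sign b * SignType.sign d) := by ring
    _ = |d| * SignType.sign b := by rw [sign_eq_one, mul_one]

theorem chartDensity_eq_abs_det_mul (hj : IsComplexStructure (𝓡∂ 2) j) (η : DForm (𝓡∂ 2) S 2)
    {i k : S} {y : ℝ²} (hy : y ∈ ((extChartAt (𝓡∂ 2) i).symm ≫ extChartAt (𝓡∂ 2) k).source) :
    chartDensity j i η y =
      |(chartDeriv (𝓡∂ 2) k ((extChartAt (𝓡∂ 2) i).symm y) ∘L chartSymmDeriv (𝓡∂ 2) i y).det| *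
        chartDensity j k η (extChartAt (𝓡∂ 2) k ((extChartAt (𝓡∂ 2) i).symm y)) := by
  have hyi : y ∈ (extChartAt (𝓡∂ 2) i).target := hy.1
  have hyk : (extChartAt (𝓡∂ 2) i).symm y ∈ (extChartAt (𝓡∂ 2) k).source := hy.2
  set L := chartDeriv (𝓡∂ 2) k ((extChartAt (𝓡∂ 2) i).symm y) ∘L chartSymmDeriv (𝓡∂ 2) i y
  have form_eq : formInChart (𝓡∂ 2) η i y ![e₀, e₁] = L.det *
      formInChart (𝓡∂ 2) η k (extChartAt (𝓡∂ 2) k ((extChartAt (𝓡∂ 2) i).symm y)) ![e₀, e₁] := by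
    rw [formInChart_apply_two, ← formInChart_chartDeriv_apply_two η hyk, twoForm_apply_plane,
      det_plane]
    rfl
  have semiconj (v : ℝ²) : endoInChart (𝓡∂ 2) j k
      (extChartAt (𝓡∂ 2) k ((extChartAt (𝓡∂ 2) i).symm y)) (L v) =
        L (endoInChart (𝓡∂ 2) j i y v) := by
    refine (endoInChart_chartDeriv hyk _).trans ?_
    change _ = chartDeriv (𝓡∂ 2) k _ (chartSymmDeriv (𝓡∂ 2) i y _)
    rw [chartSymmDeriv_endoInChart hyi]
    rfl
  have det_pos := det_mul_pos_of_semiconj (L := L)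
    (hj.endoInChart_sq ((extChartAt (𝓡∂ 2) k).map_source hyk))
    ((chartDeriv_injective hyk).comp (chartSymmDeriv_injective hyi)) semiconj
  rw [chartDensity, chartDensity, form_eq, ← mul_assoc, ← mul_assoc, chartSign, chartSign,
    sign_mul_eq_abs_mul_sign det_pos]

theorem chartIntegral_eq_of_support (hj : IsComplexStructure (𝓡∂ 2) j) {η : DForm (𝓡∂ 2) S 2}
    {i k : S} (hi : ∀ z ∉ (extChartAt (𝓡∂ 2) i).source, η z = 0)
    (hk : ∀ z ∉ (extChartAt (𝓡∂ 2) k).source, η z = 0) :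
    chartIntegral j i η = chartIntegral j k η := by
  set T := (extChartAt (𝓡∂ 2) i).symm ≫ extChartAt (𝓡∂ 2) k
  calc chartIntegral j i η
      = ∫ y in T.source, chartDensity j i η y := chartIntegral_eq_setIntegral_overlap hk
    _ = ∫ y in T.source, |(chartDeriv (𝓡∂ 2) k ((extChartAt (𝓡∂ 2) i).symm y) ∘L
          chartSymmDeriv (𝓡∂ 2) i y).det| • chartDensity j k η (T y) :=
        MeasureTheory.setIntegral_congr_fun (measurableSet_extChartAt_trans_source i k)
          fun _ hy => chartDensity_eq_abs_det_mul hj η hy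
    _ = ∫ y in T '' T.source, chartDensity j k η y :=
        (MeasureTheory.integral_image_eq_integral_abs_det_fderiv_smul _
          (measurableSet_extChartAt_trans_source i k)
          (fun _ hy => hasFDerivWithinAt_extChartAt_trans hy) T.injOn _).symm
    _ = chartIntegral j k η := by
        rw [T.image_source_eq_target, chartIntegral_eq_setIntegral_overlap hi]
        rfl

end ChartIntegral

section SurfaceIntegral

variable {S : Type*} [TopologicalSpace S] [ChartedSpace (EuclideanHalfSpace 2) S]
  [IsManifold (𝓡∂ 2) ∞ S]
  {j : ∀ z : S, TangentSpace (𝓡∂ 2) z →L[ℝ] TangentSpace (𝓡∂ 2) z}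

theorem chartIntegral_nonneg (hj : IsComplexStructure (𝓡∂ 2) j) {η : DForm (𝓡∂ 2) S 2}
    (hη : ∀ z ξ, 0 ≤ η z ![ξ, j z ξ]) (i : S) : 0 ≤ chartIntegral j i η :=
  MeasureTheory.setIntegral_nonneg (measurableSet_extChartAt_target i) fun _ hy =>
    chartDensity_nonneg hj hy (hη _)

theorem eq_zero_of_chartIntegral_eq_zero (hj : IsComplexStructure (𝓡∂ 2) j)
    {η : DForm (𝓡∂ 2) S 2} (hη_smooth : SmoothForm (𝓡∂ 2) η) (hη : ∀ z ξ, 0 ≤ η z ![ξ, j z ξ])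
    {i : S} (hη_int : MeasureTheory.IntegrableOn (chartDensity j i η) (extChartAt (𝓡∂ 2) i).target)
    (h_zero : chartIntegral j i η = 0) {z : S} (hz : z ∈ (extChartAt (𝓡∂ 2) i).source)
    (v w : TangentSpace (𝓡∂ 2) z) : η z ![v, w] = 0 := by
  have hy := (extChartAt (𝓡∂ 2) i).map_source hz
  have ae_nonneg : 0 ≤ᵐ[MeasureTheory.volume.restrict (extChartAt (𝓡∂ 2) i).target]
      chartDensity j i η :=
    (MeasureTheory.ae_restrict_iff' (measurableSet_extChartAt_target i)).2
      (.of_forall fun y hy => chartDensity_nonneg hj hy (hη _))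
  have ae_zero := (MeasureTheory.setIntegral_eq_zero_iff_of_nonneg_ae ae_nonneg hη_int).1 h_zero
  have density_zero : chartDensity j i η (extChartAt (𝓡∂ 2) i z) = 0 :=
    MeasureTheory.Measure.eqOn_of_ae_eq ae_zero (continuousOn_chartDensity hj hη_smooth i)
      continuousOn_const extChartAt_target_subset_closure_interior hy
  have sign_ne_zero : chartSign j i (extChartAt (𝓡∂ 2) i z) ≠ 0 := by
    rcases chartSign_eq_or hj hy with h | h <;> rw [h] <;> norm_num
  rw [← formInChart_chartDeriv_apply_two _ hz, twoForm_apply_plane,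
    (mul_eq_zero.1 density_zero).resolve_left sign_ne_zero, mul_zero]

variable [T2Space S] [CompactSpace S]

theorem tsupport_chartPartition_subset (i : S) :
    tsupport (chartPartition S i) ⊆ (extChartAt (𝓡∂ 2) i).source := by
  rw [extChartAt_source]
  exact (SmoothPartitionOfUnity.exists_isSubordinate_chartAt_source (𝓡∂ 2) S).choose_spec i

theorem finite_support_chartPartition :
    {i : S | (Function.support (chartPartition S i)).Nonempty}.Finite :=
  (chartPartition S).locallyFinite.finite_nonempty_of_compact

variable (S) in
/-- The indices of the non-zero members of the partition of unity; there are finitely many of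
them because `S` is compact. -/
def partitionIndices : Finset S := (finite_support_chartPartition (S := S)).toFinset

theorem chartPartition_eq_zero {i : S} (hi : i ∉ partitionIndices S) (z : S) :
    chartPartition S i z = 0 := by
  by_contra h
  exact hi ((Set.Finite.mem_toFinset _).2 ⟨z, h⟩)

theorem sum_chartPartition (z : S) : ∑ i ∈ partitionIndices S, chartPartition S i z = 1 := by
  rw [← (chartPartition S).sum_eq_one (Set.mem_univ z)]
  refine (finsum_eq_sum_of_support_subset _ fun i hi => ?_).symm
  by_contra h
  exact hi (chartPartition_eq_zero h z)

/-- The part of a form that the partition of unity assigns to the chart around `i`. -/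
def localPart {k : ℕ} (i : S) (η : DForm (𝓡∂ 2) S k) : DForm (𝓡∂ 2) S k :=
  fun z => chartPartition S i z • η z

section LocalPart

variable {k : ℕ} {η : DForm (𝓡∂ 2) S k} {i z : S}

theorem SmoothForm.localPart (hη : SmoothForm (𝓡∂ 2) η) (i : S) :
    SmoothForm (𝓡∂ 2) (localPart i η) :=
  hη.smul (chartPartition S i).contMDiff

theorem localPart_eq_zero (hz : z ∉ tsupport (chartPartition S i)) : localPart i η z = 0 := by
  rw [localPart, image_eq_zero_of_notMem_tsupport hz]
  exact zero_smul ℝ (η z)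

theorem localPart_eq_zero_of_eq_zero (hz : η z = 0) : localPart i η z = 0 := by
  rw [localPart, hz]
  exact smul_zero _

theorem sum_localPart (η : DForm (𝓡∂ 2) S k) : ∑ i ∈ partitionIndices S, localPart i η = η := by
  funext z
  simp only [Finset.sum_apply, localPart]
  rw [← Finset.sum_smul, sum_chartPartition]
  exact one_smul ℝ (η z)

theorem localPart_sum {ι : Type*} (s : Finset ι) (η : ι → DForm (𝓡∂ 2) S k) (i : S) :
    localPart i (∑ a ∈ s, η a) = ∑ a ∈ s, localPart i (η a) := by
  funext z
  simp only [localPart, Finset.sum_apply, Finset.smul_sum]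

end LocalPart

theorem chartIntegral_localPart (i : S) (η : DForm (𝓡∂ 2) S 2) :
    chartIntegral j i (localPart i η) = ∫ y in (extChartAt (𝓡∂ 2) i).target,
      chartPartition S i ((extChartAt (𝓡∂ 2) i).symm y) * chartDensity j i η y := by
  rw [chartIntegral]
  congr 1
  funext y
  exact mul_left_comm (chartSign j i y) (chartPartition S i ((extChartAt (𝓡∂ 2) i).symm y))
    (formInChart (𝓡∂ 2) η i y _)

theorem surfaceIntegral_eq_sum (η : DForm (𝓡∂ 2) S 2) :
    surfaceIntegral j η = ∑ i ∈ partitionIndices S, chartIntegral j i (localPart i η) := by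
  simp only [chartIntegral_localPart]
  refine finsum_eq_sum_of_support_subset _ fun i hi => ?_
  by_contra h
  exact hi (by simp only [chartPartition_eq_zero h, zero_mul, MeasureTheory.integral_zero])

theorem integrableOn_chartDensity_localPart (hj : IsComplexStructure (𝓡∂ 2) j)
    {η : DForm (𝓡∂ 2) S 2} (hη : SmoothForm (𝓡∂ 2) η) (i : S) :
    MeasureTheory.IntegrableOn (chartDensity j i (localPart i η)) (extChartAt (𝓡∂ 2) i).target :=
  integrableOn_chartDensity hj (hη.localPart i) (isClosed_tsupport _).isCompact
    (tsupport_chartPartition_subset i) fun _ => localPart_eq_zero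

theorem surfaceIntegral_sum (hj : IsComplexStructure (𝓡∂ 2) j) {ι : Type*} (s : Finset ι)
    {η : ι → DForm (𝓡∂ 2) S 2} (hη : ∀ a ∈ s, SmoothForm (𝓡∂ 2) (η a)) :
    surfaceIntegral j (∑ a ∈ s, η a) = ∑ a ∈ s, surfaceIntegral j (η a) := by
  simp only [surfaceIntegral_eq_sum, localPart_sum]
  rw [Finset.sum_comm]
  exact Finset.sum_congr rfl fun i _ =>
    chartIntegral_sum i s _ fun a ha => integrableOn_chartDensity_localPart hj (hη a ha) i

theorem surfaceIntegral_add (hj : IsComplexStructure (𝓡∂ 2) j) {η η' : DForm (𝓡∂ 2) S 2}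
    (hη : SmoothForm (𝓡∂ 2) η) (hη' : SmoothForm (𝓡∂ 2) η') :
    surfaceIntegral j (fun z => η z + η' z) = surfaceIntegral j η + surfaceIntegral j η' := by
  have sum_eq := surfaceIntegral_sum hj Finset.univ (η := ![η, η']) fun a _ => by
    fin_cases a <;> assumption
  rwa [Fin.sum_univ_two, Fin.sum_univ_two] at sum_eq

theorem surfaceIntegral_eq_chartIntegral (hj : IsComplexStructure (𝓡∂ 2) j)
    {η : DForm (𝓡∂ 2) S 2} (hη : SmoothForm (𝓡∂ 2) η) {i : S} {C : Set S} (hC : IsCompact C)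
    (hCi : C ⊆ (extChartAt (𝓡∂ 2) i).source) (hηC : ∀ z ∉ C, η z = 0) :
    surfaceIntegral j η = chartIntegral j i η := by
  conv_rhs => rw [← sum_localPart η]
  rw [chartIntegral_sum i _ _ fun a _ => integrableOn_chartDensity hj (hη.localPart a) hC hCi
    fun z hz => localPart_eq_zero_of_eq_zero (hηC z hz), surfaceIntegral_eq_sum]
  exact Finset.sum_congr rfl fun k _ => chartIntegral_eq_of_support hj
    (fun z hz => localPart_eq_zero fun h => hz (tsupport_chartPartition_subset k h))
    (fun z hz => localPart_eq_zero_of_eq_zero (hηC z fun h => hz (hCi h)))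

theorem localPart_nonneg {η : DForm (𝓡∂ 2) S 2} (hη : ∀ z ξ, 0 ≤ η z ![ξ, j z ξ]) (i z : S)
    (ξ : TangentSpace (𝓡∂ 2) z) : 0 ≤ localPart i η z ![ξ, j z ξ] :=
  mul_nonneg ((chartPartition S).nonneg i z) (hη z ξ)

theorem surfaceIntegral_nonneg (hj : IsComplexStructure (𝓡∂ 2) j) {η : DForm (𝓡∂ 2) S 2}
    (hη : ∀ z ξ, 0 ≤ η z ![ξ, j z ξ]) : 0 ≤ surfaceIntegral j η := by
  rw [surfaceIntegral_eq_sum]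
  exact Finset.sum_nonneg fun i _ => chartIntegral_nonneg hj (localPart_nonneg hη i) i

theorem eq_zero_of_surfaceIntegral_eq_zero (hj : IsComplexStructure (𝓡∂ 2) j)
    {η : DForm (𝓡∂ 2) S 2} (hη_smooth : SmoothForm (𝓡∂ 2) η) (hη : ∀ z ξ, 0 ≤ η z ![ξ, j z ξ])
    (h_zero : surfaceIntegral j η = 0) (z : S) (v w : TangentSpace (𝓡∂ 2) z) :
    η z ![v, w] = 0 := by
  rw [surfaceIntegral_eq_sum, Finset.sum_eq_zero_iff_of_nonneg fun i _ =>
    chartIntegral_nonneg hj (localPart_nonneg hη i) i] at h_zero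
  obtain ⟨i, hi, hiz⟩ : ∃ i ∈ partitionIndices S, chartPartition S i z ≠ 0 :=
    Finset.exists_ne_zero_of_sum_ne_zero (by rw [sum_chartPartition z]; exact one_ne_zero)
  have localPart_zero : localPart i η z ![v, w] = 0 :=
    eq_zero_of_chartIntegral_eq_zero hj (hη_smooth.localPart i) (localPart_nonneg hη i)
      (integrableOn_chartDensity_localPart hj hη_smooth i) (h_zero i hi)
      (tsupport_chartPartition_subset i (subset_tsupport _ hiz)) v w
  exact (mul_eq_zero.1 localPart_zero).resolve_left hiz

end SurfaceIntegral

section HalfPlane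

theorem setIntegral_divergence_halfPlane {f g : ℝ × ℝ → ℝ} {f' g' : ℝ × ℝ → ℝ × ℝ →L[ℝ] ℝ}
    {C : Set (ℝ × ℝ)} (hC : IsCompact C) (hf_zero : ∀ p ∉ C, f p = 0) (hg_zero : ∀ p ∉ C, g p = 0)
    (hdiv_zero : ∀ p ∉ C, f' p (1, 0) + g' p (0, 1) = 0)
    (hf : ContinuousOn f {p | 0 ≤ p.1}) (hg : ContinuousOn g {p | 0 ≤ p.1})
    (hdiv : ContinuousOn (fun p => f' p (1, 0) + g' p (0, 1)) {p | 0 ≤ p.1})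
    (hf' : ∀ p : ℝ × ℝ, 0 < p.1 → HasFDerivAt f (f' p) p)
    (hg' : ∀ p : ℝ × ℝ, 0 < p.1 → HasFDerivAt g (g' p) p) :
    ∫ p in {p : ℝ × ℝ | 0 ≤ p.1}, (f' p (1, 0) + g' p (0, 1)) = -∫ t : ℝ, f (0, t) := by
  obtain ⟨R, hR, hCR⟩ : ∃ R : ℝ, 0 < R ∧ ∀ p ∈ C, |p.1| < R ∧ |p.2| < R := by
    obtain ⟨R, hR⟩ := hC.isBounded.exists_norm_le
    exact ⟨|R| + 1, by positivity, fun p hp => max_lt_iff.1 <|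
      ((hR p hp).trans (le_abs_self R)).trans_lt (lt_add_one _)⟩
  have notMem_of_le_fst : ∀ p : ℝ × ℝ, R ≤ |p.1| → p ∉ C := fun p hp h =>
    (hCR p h).1.not_ge hp
  have notMem_of_le_snd : ∀ p : ℝ × ℝ, R ≤ |p.2| → p ∉ C := fun p hp h =>
    (hCR p h).2.not_ge hp
  have box_subset : Set.Icc ((0, -R) : ℝ × ℝ) (R, R) ⊆ {p | 0 ≤ p.1} := fun p hp => hp.1.1
  have box_divergence := MeasureTheory.integral_divergence_prod_Icc_of_hasFDerivAt_of_le
    f g f' g' (0, -R) (R, R) ⟨hR.le, (neg_lt_self hR).le⟩ (hf.mono box_subset)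
    (hg.mono box_subset) (fun p hp => hf' p hp.1.1) (fun p hp => hg' p hp.1.1)
    ((hdiv.mono box_subset).integrableOn_compact isCompact_Icc)
  have top_face : ∫ x in (0 : ℝ)..R, g (x, R) = 0 :=
    intervalIntegral.integral_zero_ae <| .of_forall fun x _ =>
      hg_zero _ (notMem_of_le_snd (x, R) (le_abs_self R))
  have bottom_face : ∫ x in (0 : ℝ)..R, g (x, -R) = 0 :=
    intervalIntegral.integral_zero_ae <| .of_forall fun x _ =>
      hg_zero _ (notMem_of_le_snd (x, -R) (by simpa using le_abs_self R))
  have right_face : ∫ y in (-R)..R, f (R, y) = 0 :=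
    intervalIntegral.integral_zero_ae <| .of_forall fun y _ =>
      hf_zero _ (notMem_of_le_fst (R, y) (le_abs_self R))
  have left_face : ∫ y in (-R)..R, f (0, y) = ∫ t : ℝ, f (0, t) := by
    rw [intervalIntegral.integral_of_le (neg_lt_self hR).le]
    refine MeasureTheory.setIntegral_eq_integral_of_forall_compl_eq_zero fun t ht =>
      hf_zero _ (notMem_of_le_snd (0, t) ?_)
    by_contra! t_lt
    exact ht ⟨(abs_lt.1 t_lt).1, (abs_lt.1 t_lt).2.le⟩
  rw [top_face, bottom_face, right_face, left_face, sub_self, zero_add, zero_sub] at box_divergence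
  rw [← box_divergence]
  refine MeasureTheory.setIntegral_eq_of_subset_of_forall_sdiff_eq_zero
    (measurableSet_le measurable_const measurable_fst) box_subset fun p hp =>
      hdiv_zero p fun hpC => hp.2 ?_
  obtain ⟨p_fst, p_snd⟩ := hCR p hpC
  exact ⟨⟨hp.1, (abs_lt.1 p_snd).1.le⟩, ⟨(abs_lt.1 p_fst).2.le, (abs_lt.1 p_snd).2.le⟩⟩

/-- The identification of `ℝ × ℝ` with the Euclidean plane. -/
def planeEquiv : (ℝ × ℝ) ≃L[ℝ] ℝ² :=
  (ContinuousLinearEquiv.finTwoArrow ℝ ℝ).symm.trans (EuclideanSpace.equiv (Fin 2) ℝ).symm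

theorem planeEquiv_one_zero : planeEquiv (1, 0) = e₀ := by
  ext i
  fin_cases i <;> simp [planeEquiv]

theorem planeEquiv_zero_one : planeEquiv (0, 1) = e₁ := by
  ext i
  fin_cases i <;> simp [planeEquiv]

theorem measurePreserving_planeEquiv : MeasureTheory.MeasurePreserving planeEquiv :=
  (PiLp.volume_preserving_toLp (Fin 2)).comp (MeasureTheory.volume_preserving_finTwoArrow ℝ).symm

theorem continuous_boundaryLine : Continuous fun t : ℝ => !₂[(0 : ℝ), t] :=
  planeEquiv.continuous.comp (Continuous.prodMk_right (0 : ℝ) (Y := ℝ))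

theorem planeEquiv_preimage_range_halfSpace :
    planeEquiv ⁻¹' Set.range (𝓡∂ 2) = {p | 0 ≤ p.1} := by
  rw [range_modelWithCornersEuclideanHalfSpace]
  rfl

theorem setIntegral_extDeriv_halfPlane {G : ℝ² → ℝ² [⋀^Fin 1]→L[ℝ] ℝ}
    {D : ℝ² → ℝ² →L[ℝ] ℝ² [⋀^Fin 1]→L[ℝ] ℝ} {C : Set ℝ²} (hC : IsCompact C)
    (hG_zero : ∀ y ∉ C, G y = 0) (hD_zero : ∀ y ∉ C, D y = 0)
    (hG : ContinuousOn G (Set.range (𝓡∂ 2))) (hD : ContinuousOn D (Set.range (𝓡∂ 2)))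
    (hGD : ∀ y : ℝ², 0 < y 0 → HasFDerivAt G (D y) y) :
    ∫ y in Set.range (𝓡∂ 2), (D y e₀ ![e₁] - D y e₁ ![e₀]) = -∫ t : ℝ, G !₂[0, t] ![e₁] := by
  let ev (v : ℝ²) : (ℝ² [⋀^Fin 1]→L[ℝ] ℝ) →L[ℝ] ℝ :=
    ContinuousAlternatingMap.apply ℝ ℝ² ℝ ![v]
  let f (p : ℝ × ℝ) : ℝ := ev e₁ (G (planeEquiv p))
  let g (p : ℝ × ℝ) : ℝ := -ev e₀ (G (planeEquiv p))
  let f' (p : ℝ × ℝ) : ℝ × ℝ →L[ℝ] ℝ :=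
    ev e₁ ∘L D (planeEquiv p) ∘L (planeEquiv : (ℝ × ℝ) →L[ℝ] ℝ²)
  let g' (p : ℝ × ℝ) : ℝ × ℝ →L[ℝ] ℝ :=
    -(ev e₀ ∘L D (planeEquiv p) ∘L (planeEquiv : (ℝ × ℝ) →L[ℝ] ℝ²))
  have divergence_eq (p : ℝ × ℝ) : f' p (1, 0) + g' p (0, 1) =
      D (planeEquiv p) e₀ ![e₁] - D (planeEquiv p) e₁ ![e₀] := by
    change D (planeEquiv p) (planeEquiv (1, 0)) ![e₁] +
      -(D (planeEquiv p) (planeEquiv (0, 1)) ![e₀]) = _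
    rw [planeEquiv_one_zero, planeEquiv_zero_one, ← sub_eq_add_neg]
  have maps : Set.MapsTo planeEquiv {p | 0 ≤ p.1} (Set.range (𝓡∂ 2)) :=
    planeEquiv_preimage_range_halfSpace.ge
  have continuousOn_G : ContinuousOn (fun p => G (planeEquiv p)) {p | 0 ≤ p.1} :=
    hG.comp planeEquiv.continuous.continuousOn maps
  have continuousOn_D (v w : ℝ²) :
      ContinuousOn (fun p => D (planeEquiv p) v ![w]) {p | 0 ≤ p.1} :=
    (ev w).continuous.comp_continuousOn
      ((hD.comp planeEquiv.continuous.continuousOn maps).clm_apply continuousOn_const)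
  have hasFDerivAt_G (p : ℝ × ℝ) (hp : 0 < p.1) : HasFDerivAt (fun p => G (planeEquiv p))
      (D (planeEquiv p) ∘L (planeEquiv : (ℝ × ℝ) →L[ℝ] ℝ²)) p :=
    (hGD (planeEquiv p) hp).comp p planeEquiv.hasFDerivAt
  have stokes := setIntegral_divergence_halfPlane (f := f) (g := g) (f' := f') (g' := g')
    (planeEquiv.toHomeomorph.isCompact_preimage.2 hC)
    (fun p hp => (congrArg (ev e₁) (hG_zero (planeEquiv p) hp)).trans (map_zero _))
    (fun p hp => neg_eq_zero.2
      ((congrArg (ev e₀) (hG_zero (planeEquiv p) hp)).trans (map_zero _)))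
    (fun p hp => by rw [divergence_eq, hD_zero (planeEquiv p) hp]; exact sub_self 0)
    ((ev e₁).continuous.comp_continuousOn continuousOn_G)
    ((ev e₀).continuous.comp_continuousOn continuousOn_G).neg
    (by simp only [divergence_eq]; exact (continuousOn_D e₀ e₁).sub (continuousOn_D e₁ e₀))
    (fun p hp => (ev e₁).hasFDerivAt.comp p (hasFDerivAt_G p hp))
    (fun p hp => ((ev e₀).hasFDerivAt.comp p (hasFDerivAt_G p hp)).neg)
  simp only [divergence_eq] at stokes
  rw [← measurePreserving_planeEquiv.setIntegral_preimage_emb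
    planeEquiv.toHomeomorph.measurableEmbedding, planeEquiv_preimage_range_halfSpace]
  exact stokes

end HalfPlane

section ExtensionByZero

variable {X F : Type*} {T C : Set X}

theorem continuousOn_indicator_of_isClosed [TopologicalSpace X] [TopologicalSpace F] [Zero F]
    {R : Set X} {f : X → F} (hC : IsClosed C) (hCT : C ⊆ T) (hT : ∀ y ∈ T, T ∈ 𝓝[R] y)
    (hf : ContinuousOn f T) (hf_zero : ∀ y ∈ T, y ∉ C → f y = 0) :
    ContinuousOn (T.indicator f) R := by
  intro y _
  by_cases hy : y ∈ T
  · refine ((hf y hy).mono_of_mem_nhdsWithin (hT y hy)).congr_of_eventuallyEq ?_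
      (Set.indicator_of_mem hy f)
    filter_upwards [hT y hy] with x hx using Set.indicator_of_mem hx f
  · have eventually_zero : ∀ᶠ x in 𝓝 y, T.indicator f x = 0 := by
      filter_upwards [hC.isOpen_compl.mem_nhds fun h => hy (hCT h)] with x hx
      exact Set.indicator_apply_eq_zero.2 fun hxT => hf_zero x hxT hx
    exact (continuousWithinAt_const (b := (0 : F))).congr_of_eventuallyEq
      (nhdsWithin_le_nhds eventually_zero) eventually_zero.self_of_nhds

theorem hasFDerivAt_indicator_of_isClosed [NormedAddCommGroup X] [NormedSpace ℝ X]
    [NormedAddCommGroup F] [NormedSpace ℝ F] {f : X → F} {f' : X → X →L[ℝ] F} {y : X}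
    (hC : IsClosed C) (hCT : C ⊆ T) (hT : y ∈ T → T ∈ 𝓝 y)
    (hf : y ∈ T → HasFDerivAt f (f' y) y) (hf_zero : ∀ y ∈ T, y ∉ C → f y = 0) :
    HasFDerivAt (T.indicator f) (T.indicator f' y) y := by
  by_cases hy : y ∈ T
  · rw [Set.indicator_of_mem hy]
    refine (hf hy).congr_of_eventuallyEq ?_
    filter_upwards [hT hy] with x hx using Set.indicator_of_mem hx f
  · rw [Set.indicator_of_notMem hy]
    refine (hasFDerivAt_const (0 : F) y).congr_of_eventuallyEq ?_
    filter_upwards [hC.isOpen_compl.mem_nhds fun h => hy (hCT h)] with x hx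
    exact Set.indicator_apply_eq_zero.2 fun hxT => hf_zero x hxT hx

end ExtensionByZero

section Stokes

variable {S : Type*} [TopologicalSpace S] [ChartedSpace (EuclideanHalfSpace 2) S]
  {j : ∀ z : S, TangentSpace (𝓡∂ 2) z →L[ℝ] TangentSpace (𝓡∂ 2) z}

/-- The coordinates `t` of the points `(0, t)` of the half-plane that lie in the image of the
chart around `i`. -/
def boundaryDomain (i : S) : Set ℝ := {t | !₂[(0 : ℝ), t] ∈ (extChartAt (𝓡∂ 2) i).target}

/-- The density that a one-form has on the boundary in the chart around `i`, with the sign that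
makes it independent of the orientation of the chart. -/
def boundaryDensity (j : ∀ z : S, TangentSpace (𝓡∂ 2) z →L[ℝ] TangentSpace (𝓡∂ 2) z) (i : S)
    (η : DForm (𝓡∂ 2) S 1) (t : ℝ) : ℝ :=
  chartSign j i !₂[(0 : ℝ), t] * formInChart (𝓡∂ 2) η i !₂[(0 : ℝ), t] ![-e₁]

theorem measurableSet_boundaryDomain (i : S) : MeasurableSet (boundaryDomain i) :=
  continuous_boundaryLine.measurable (measurableSet_extChartAt_target i)

theorem boundaryDensity_eq_zero {η : DForm (𝓡∂ 2) S 1} {i : S} {t : ℝ}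
    (hη : η ((extChartAt (𝓡∂ 2) i).symm !₂[(0 : ℝ), t]) = 0) : boundaryDensity j i η t = 0 := by
  rw [boundaryDensity, formInChart_eq_zero hη]
  exact mul_zero _

section ChartStokes

variable {η : DForm (𝓡∂ 2) S 1} {i : S} {y : ℝ²}

theorem SmoothForm.continuousOn_fderivWithin_formInChart (hη : SmoothForm (𝓡∂ 2) η) (i : S) :
    ContinuousOn (fderivWithin ℝ (formInChart (𝓡∂ 2) η i) (Set.range (𝓡∂ 2)))
      (extChartAt (𝓡∂ 2) i).target := fun _ hy =>
  (((hη.contDiffWithinAt hy).fderivWithin_right (m := 0) (𝓡∂ 2).uniqueDiffOn (by simp)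
    (extChartAt_target_subset_range i hy)).continuousWithinAt).mono
      (extChartAt_target_subset_range i)

theorem fderivWithin_formInChart_eq_zero {C : Set S} (hC : IsCompact C)
    (hCi : C ⊆ (extChartAt (𝓡∂ 2) i).source) (hηC : ∀ z ∉ C, η z = 0)
    (hy : y ∈ (extChartAt (𝓡∂ 2) i).target) (hyC : y ∉ extChartAt (𝓡∂ 2) i '' C) :
    fderivWithin ℝ (formInChart (𝓡∂ 2) η i) (Set.range (𝓡∂ 2)) y = 0 := by
  have formInChart_zero : ∀ x ∈ (extChartAt (𝓡∂ 2) i).target, x ∉ extChartAt (𝓡∂ 2) i '' C →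
      formInChart (𝓡∂ 2) η i x = 0 := fun x hx hxC =>
    formInChart_eq_zero (hηC _ (symm_notMem_of_notMem_image hx hxC))
  have eventually_zero :
      formInChart (𝓡∂ 2) η i =ᶠ[𝓝[Set.range (𝓡∂ 2)] y] fun _ => 0 := by
    filter_upwards [extChartAt_target_mem_nhdsWithin_of_mem hy, nhdsWithin_le_nhds
      ((isCompact_image_extChartAt hC hCi).isClosed.isOpen_compl.mem_nhds hyC)] with x hx hxC
      using formInChart_zero x hx hxC
  rw [eventually_zero.fderivWithin_eq (formInChart_zero y hy hyC), fderivWithin_fun_const]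
  rfl

theorem hasFDerivAt_chartSign_smul_formInChart [IsManifold (𝓡∂ 2) ∞ S]
    (hj : IsComplexStructure (𝓡∂ 2) j)
    (hη : SmoothForm (𝓡∂ 2) η) (hy : y ∈ (extChartAt (𝓡∂ 2) i).target)
    (hy_nhds : (extChartAt (𝓡∂ 2) i).target ∈ 𝓝 y) :
    HasFDerivAt (fun x => chartSign j i x • formInChart (𝓡∂ 2) η i x)
      (chartSign j i y • fderivWithin ℝ (formInChart (𝓡∂ 2) η i) (Set.range (𝓡∂ 2)) y) y := by
  have range_nhds : Set.range (𝓡∂ 2) ∈ 𝓝 y :=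
    Filter.mem_of_superset hy_nhds (extChartAt_target_subset_range i)
  have hasFDerivAt_formInChart :=
    (hη.differentiableWithinAt hy).hasFDerivWithinAt.hasFDerivAt range_nhds
  refine (hasFDerivAt_formInChart.const_smul (chartSign j i y)).congr_of_eventuallyEq ?_
  have sign_eventually := chartSign_eventuallyEq hj hy
  rw [nhdsWithin_eq_nhds.2 hy_nhds] at sign_eventually
  filter_upwards [sign_eventually] with x hx
  rw [hx]
  rfl

theorem extChartAt_target_mem_nhds_of_pos (hy : y ∈ (extChartAt (𝓡∂ 2) i).target)
    (hy_pos : 0 < y 0) : (extChartAt (𝓡∂ 2) i).target ∈ 𝓝 y := by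
  have range_nhds : Set.range (𝓡∂ 2) ∈ 𝓝 y := by
    rw [← mem_interior_iff_mem_nhds, interior_range_modelWithCornersEuclideanHalfSpace]
    exact hy_pos
  rw [← nhdsWithin_eq_nhds.2 range_nhds]
  exact extChartAt_target_mem_nhdsWithin_of_mem hy

theorem setIntegral_boundaryDensity_eq_neg_integral (η : DForm (𝓡∂ 2) S 1) (i : S) :
    ∫ t in boundaryDomain i, boundaryDensity j i η t =
      -∫ t : ℝ, (extChartAt (𝓡∂ 2) i).target.indicator
        (fun y => chartSign j i y • formInChart (𝓡∂ 2) η i y) !₂[0, t] ![e₁] := by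
  rw [← MeasureTheory.integral_indicator (measurableSet_boundaryDomain i),
    ← MeasureTheory.integral_neg]
  congr 1
  funext t
  by_cases ht : t ∈ boundaryDomain i
  · have mem_target : !₂[(0 : ℝ), t] ∈ (extChartAt (𝓡∂ 2) i).target := ht
    rw [Set.indicator_of_mem ht, Set.indicator_of_mem mem_target, boundaryDensity, oneForm_neg,
      mul_neg]
    rfl
  · have notMem_target : !₂[(0 : ℝ), t] ∉ (extChartAt (𝓡∂ 2) i).target := ht
    rw [Set.indicator_of_notMem ht, Set.indicator_of_notMem notMem_target]
    exact neg_zero.symm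

variable [IsManifold (𝓡∂ 2) ∞ S]

theorem chartIntegral_extD_eq_setIntegral_range (j : ∀ z : S, TangentSpace (𝓡∂ 2) z →L[ℝ]
    TangentSpace (𝓡∂ 2) z) (hη : SmoothForm (𝓡∂ 2) η) (i : S) :
    letI D := (extChartAt (𝓡∂ 2) i).target.indicator fun y =>
      chartSign j i y • fderivWithin ℝ (formInChart (𝓡∂ 2) η i) (Set.range (𝓡∂ 2)) y
    chartIntegral j i (extD (𝓡∂ 2) η) =
      ∫ y in Set.range (𝓡∂ 2), (D y e₀ ![e₁] - D y e₁ ![e₀]) := by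
  rw [chartIntegral, MeasureTheory.setIntegral_eq_of_subset_of_forall_sdiff_eq_zero
    (𝓡∂ 2).isClosed_range.measurableSet (extChartAt_target_subset_range i)]
  · refine MeasureTheory.setIntegral_congr_fun (measurableSet_extChartAt_target i) fun y hy => ?_
    simp only [Set.indicator_of_mem hy]
    rw [chartDensity, formInChart_extD hη hy, extDerivWithin_oneForm_apply]
    exact mul_sub _ _ _
  · rintro y ⟨-, hy⟩
    simp only [Set.indicator_of_notMem hy]
    exact sub_self 0

theorem chartIntegral_extD (hj : IsComplexStructure (𝓡∂ 2) j) (hη : SmoothForm (𝓡∂ 2) η)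
    {C : Set S} (hC : IsCompact C) (hCi : C ⊆ (extChartAt (𝓡∂ 2) i).source)
    (hηC : ∀ z ∉ C, η z = 0) :
    chartIntegral j i (extD (𝓡∂ 2) η) = ∫ t in boundaryDomain i, boundaryDensity j i η t := by
  set T := (extChartAt (𝓡∂ 2) i).target
  set ζ := formInChart (𝓡∂ 2) η i with ζ_def
  let ζ' := fderivWithin ℝ ζ (Set.range (𝓡∂ 2))
  have compact_image : IsCompact (extChartAt (𝓡∂ 2) i '' C) := isCompact_image_extChartAt hC hCi
  have image_subset : extChartAt (𝓡∂ 2) i '' C ⊆ T :=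
    ((extChartAt (𝓡∂ 2) i).mapsTo.mono_left hCi).image_subset
  have T_nhds : ∀ y ∈ T, T ∈ 𝓝[Set.range (𝓡∂ 2)] y := fun y hy =>
    extChartAt_target_mem_nhdsWithin_of_mem hy
  have form_zero : ∀ y ∈ T, y ∉ extChartAt (𝓡∂ 2) i '' C → chartSign j i y • ζ y = 0 :=
    fun y hy hyC => by
      rw [ζ_def, formInChart_eq_zero (hηC _ (symm_notMem_of_notMem_image hy hyC))]
      exact smul_zero _
  have deriv_zero : ∀ y ∈ T, y ∉ extChartAt (𝓡∂ 2) i '' C → chartSign j i y • ζ' y = 0 :=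
    fun y hy hyC => by
      rw [show ζ' y = 0 from fderivWithin_formInChart_eq_zero hC hCi hηC hy hyC]
      ext v _
      exact mul_zero _
  rw [chartIntegral_extD_eq_setIntegral_range j hη, setIntegral_boundaryDensity_eq_neg_integral]
  exact setIntegral_extDeriv_halfPlane compact_image
    (fun y hyC => Set.indicator_apply_eq_zero.2 fun hy => form_zero y hy hyC)
    (fun y hyC => Set.indicator_apply_eq_zero.2 fun hy => deriv_zero y hy hyC)
    (continuousOn_indicator_of_isClosed compact_image.isClosed image_subset T_nhds
      ((continuousOn_chartSign hj i).smul (hη i).continuousOn) form_zero)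
    (continuousOn_indicator_of_isClosed compact_image.isClosed image_subset T_nhds
      ((continuousOn_chartSign hj i).smul (hη.continuousOn_fderivWithin_formInChart i)) deriv_zero)
    fun y hy_pos => hasFDerivAt_indicator_of_isClosed compact_image.isClosed image_subset
      (fun hy => extChartAt_target_mem_nhds_of_pos hy hy_pos)
      (fun hy => hasFDerivAt_chartSign_smul_formInChart hj hη hy
        (extChartAt_target_mem_nhds_of_pos hy hy_pos)) form_zero

theorem symm_mem_boundary (hy : y ∈ (extChartAt (𝓡∂ 2) i).target) (hy_zero : y 0 = 0) :
    (extChartAt (𝓡∂ 2) i).symm y ∈ (𝓡∂ 2).boundary S := by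
  have mem_source : (extChartAt (𝓡∂ 2) i).symm y ∈ (chartAt (EuclideanHalfSpace 2) i).source := by
    rw [← extChartAt_source (𝓡∂ 2)]
    exact (extChartAt (𝓡∂ 2) i).map_target hy
  refine ((𝓡∂ 2).isBoundaryPoint_iff_not_isInteriorPoint _).2 fun interior_point => ?_
  have mem_interior := ((𝓡∂ 2).isInteriorPoint_iff_of_mem_atlas (n := ∞) (by simp)
    (chart_mem_atlas (EuclideanHalfSpace 2) i) mem_source).1 interior_point
  change extChartAt (𝓡∂ 2) i ((extChartAt (𝓡∂ 2) i).symm y) ∈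
    interior (extChartAt (𝓡∂ 2) i).target at mem_interior
  rw [(extChartAt (𝓡∂ 2) i).right_inv hy] at mem_interior
  have pos := interior_mono (extChartAt_target_subset_range i) mem_interior
  rw [interior_range_modelWithCornersEuclideanHalfSpace] at pos
  exact absurd hy_zero pos.ne'

end ChartStokes

section BoundaryTangent

/-- The positively oriented unit tangent vector of the boundary at the point `(0, t)` of the
chart around `i`. -/
def boundaryTangent (j : ∀ z : S, TangentSpace (𝓡∂ 2) z →L[ℝ] TangentSpace (𝓡∂ 2) z) (i : S)
    (t : ℝ) : TangentSpace (𝓡∂ 2) ((extChartAt (𝓡∂ 2) i).symm !₂[(0 : ℝ), t]) :=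
  chartSymmDeriv (𝓡∂ 2) i !₂[(0 : ℝ), t] (chartSign j i !₂[(0 : ℝ), t] • -e₁)

theorem boundaryDensity_eq_apply_boundaryTangent (η : DForm (𝓡∂ 2) S 1) (i : S) (t : ℝ) :
    boundaryDensity j i η t = η _ ![boundaryTangent j i t] :=
  ((formInChart (𝓡∂ 2) η i !₂[(0 : ℝ), t]).map_vecCons_smul ![] _ _).symm.trans
    (formInChart_apply_one ..)

theorem chartDeriv_boundaryTangent_pos [IsManifold (𝓡∂ 2) ∞ S] (hj : IsComplexStructure (𝓡∂ 2) j)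
    {i : S} {t : ℝ} (ht : t ∈ boundaryDomain i) :
    0 < chartDeriv (𝓡∂ 2) i _ (j _ (boundaryTangent j i t)) 0 := by
  have hy : !₂[(0 : ℝ), t] ∈ (extChartAt (𝓡∂ 2) i).target := ht
  have sq_add := complexStructure_plane_sq_add (hj.endoInChart_sq hy)
  rw [boundaryTangent, ← chartSymmDeriv_endoInChart hy, chartDeriv_chartSymmDeriv hy, map_smul,
    map_neg, chartSign]
  set A := endoInChart (𝓡∂ 2) j i !₂[(0 : ℝ), t]
  change 0 < (SignType.sign (A e₀ 1) : ℝ) * -A e₁ 0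
  rcases (endoInChart_e₀_ne_zero hj hy).lt_or_gt with neg | pos
  · rw [sign_neg neg, SignType.coe_neg_one]
    nlinarith [sq_nonneg (A e₀ 0)]
  · rw [sign_pos pos, SignType.coe_one]
    nlinarith [sq_nonneg (A e₀ 0)]

end BoundaryTangent

variable [IsManifold (𝓡∂ 2) ∞ S] [T2Space S] [CompactSpace S]

theorem boundaryDensity_localPart (η : DForm (𝓡∂ 2) S 1) (i : S) (t : ℝ) :
    boundaryDensity j i (localPart i η) t =
      chartPartition S i ((extChartAt (𝓡∂ 2) i).symm !₂[(0 : ℝ), t]) * boundaryDensity j i η t :=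
  mul_left_comm (chartSign j i !₂[(0 : ℝ), t])
    (chartPartition S i ((extChartAt (𝓡∂ 2) i).symm !₂[(0 : ℝ), t])) _

theorem boundaryIntegral_eq_sum (η : DForm (𝓡∂ 2) S 1) :
    boundaryIntegral j η =
      ∑ i ∈ partitionIndices S, ∫ t in boundaryDomain i, boundaryDensity j i (localPart i η) t := by
  simp only [boundaryDensity_localPart]
  refine finsum_eq_sum_of_support_subset _ fun i hi => ?_
  by_contra h
  exact hi (by simp only [chartPartition_eq_zero h, zero_mul, MeasureTheory.integral_zero])

theorem surfaceIntegral_extD (hj : IsComplexStructure (𝓡∂ 2) j) {η : DForm (𝓡∂ 2) S 1}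
    (hη : SmoothForm (𝓡∂ 2) η) : surfaceIntegral j (extD (𝓡∂ 2) η) = boundaryIntegral j η := by
  have extD_eq_sum : extD (𝓡∂ 2) η = ∑ i ∈ partitionIndices S, extD (𝓡∂ 2) (localPart i η) := by
    rw [← extD_sum _ fun i _ => hη.localPart i, sum_localPart]
  rw [extD_eq_sum, surfaceIntegral_sum hj _ fun i _ => (hη.localPart i).extD,
    boundaryIntegral_eq_sum]
  refine Finset.sum_congr rfl fun i _ => ?_
  have compact_tsupport : IsCompact (tsupport (chartPartition S i)) :=
    (isClosed_tsupport _).isCompact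
  have extD_zero_off : ∀ z ∉ tsupport (chartPartition S i),
      extD (𝓡∂ 2) (localPart i η) z = 0 := fun z hz => by
    refine extD_eq_zero_of_eventuallyEq ?_
    filter_upwards [(isClosed_tsupport _).isOpen_compl.mem_nhds hz] with x hx
      using localPart_eq_zero hx
  rw [surfaceIntegral_eq_chartIntegral hj (hη.localPart i).extD compact_tsupport
    (tsupport_chartPartition_subset i) extD_zero_off, chartIntegral_extD hj (hη.localPart i)
    compact_tsupport (tsupport_chartPartition_subset i) fun _ => localPart_eq_zero]

theorem continuousOn_boundaryDensity_localPart (hj : IsComplexStructure (𝓡∂ 2) j)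
    {η : DForm (𝓡∂ 2) S 1} {i : S} (hη : ContinuousOn (formInChart (𝓡∂ 2) η i)
      {y ∈ (extChartAt (𝓡∂ 2) i).target | y 0 = 0}) :
    ContinuousOn (boundaryDensity j i (localPart i η)) (boundaryDomain i) := by
  have maps : Set.MapsTo (fun t : ℝ => !₂[(0 : ℝ), t]) (boundaryDomain i)
      {y ∈ (extChartAt (𝓡∂ 2) i).target | y 0 = 0} := fun t ht => ⟨ht, rfl⟩
  have continuousOn_localPart : ContinuousOn (formInChart (𝓡∂ 2) (localPart i η) i)
      {y ∈ (extChartAt (𝓡∂ 2) i).target | y 0 = 0} :=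
    ((contDiffOn_comp_extChartAt_symm (chartPartition S i).contMDiff i).continuousOn.mono
      fun y hy => hy.1).smul hη
  exact ((continuousOn_chartSign hj i).comp continuous_boundaryLine.continuousOn fun t ht => ht).mul
    ((ContinuousAlternatingMap.apply ℝ ℝ² ℝ _).continuous.comp_continuousOn
      (continuousOn_localPart.comp continuous_boundaryLine.continuousOn maps))

theorem integrableOn_boundaryDensity_localPart (hj : IsComplexStructure (𝓡∂ 2) j)
    {η : DForm (𝓡∂ 2) S 1} {i : S} (hη : ContinuousOn (formInChart (𝓡∂ 2) η i)
      {y ∈ (extChartAt (𝓡∂ 2) i).target | y 0 = 0}) :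
    MeasureTheory.IntegrableOn (boundaryDensity j i (localPart i η)) (boundaryDomain i) := by
  set C := extChartAt (𝓡∂ 2) i '' tsupport (chartPartition S i)
  have compact_C : IsCompact C := isCompact_image_extChartAt (isClosed_tsupport _).isCompact
    (tsupport_chartPartition_subset i)
  have C_subset : C ⊆ (extChartAt (𝓡∂ 2) i).target :=
    ((extChartAt (𝓡∂ 2) i).mapsTo.mono_left (tsupport_chartPartition_subset i)).image_subset
  have compact_preimage : IsCompact ((fun t : ℝ => !₂[(0 : ℝ), t]) ⁻¹' C) :=
    (compact_C.image (EuclideanSpace.proj (𝕜 := ℝ) (1 : Fin 2)).continuous).of_isClosed_subset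
      (compact_C.isClosed.preimage continuous_boundaryLine) fun t ht => ⟨_, ht, rfl⟩
  refine MeasureTheory.IntegrableOn.of_forall_sdiff_eq_zero
    (((continuousOn_boundaryDensity_localPart hj hη).mono
      fun t ht => C_subset ht).integrableOn_compact compact_preimage)
    (measurableSet_boundaryDomain i) ?_
  rintro t ⟨ht, htC⟩
  exact boundaryDensity_eq_zero (localPart_eq_zero (symm_notMem_of_notMem_image ht htC))

theorem boundaryIntegral_mono (hj : IsComplexStructure (𝓡∂ 2) j) {η η' : DForm (𝓡∂ 2) S 1}
    (hη : ∀ i, ContinuousOn (formInChart (𝓡∂ 2) η i)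
      {y ∈ (extChartAt (𝓡∂ 2) i).target | y 0 = 0})
    (hη' : ∀ i, ContinuousOn (formInChart (𝓡∂ 2) η' i)
      {y ∈ (extChartAt (𝓡∂ 2) i).target | y 0 = 0})
    (h_le : ∀ z ∈ (𝓡∂ 2).boundary S, ∀ i : S, z ∈ (extChartAt (𝓡∂ 2) i).source →
      ∀ τ : TangentSpace (𝓡∂ 2) z, 0 < chartDeriv (𝓡∂ 2) i z (j z τ) 0 → η z ![τ] ≤ η' z ![τ]) :
    boundaryIntegral j η ≤ boundaryIntegral j η' := by
  rw [boundaryIntegral_eq_sum, boundaryIntegral_eq_sum]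
  refine Finset.sum_le_sum fun i _ => MeasureTheory.setIntegral_mono_on
    (integrableOn_boundaryDensity_localPart hj (hη i))
    (integrableOn_boundaryDensity_localPart hj (hη' i)) (measurableSet_boundaryDomain i)
    fun t ht => ?_
  rw [boundaryDensity_localPart, boundaryDensity_localPart,
    boundaryDensity_eq_apply_boundaryTangent, boundaryDensity_eq_apply_boundaryTangent]
  exact mul_le_mul_of_nonneg_left (h_le _ (symm_mem_boundary ht rfl) i
    ((extChartAt (𝓡∂ 2) i).map_target ht) _ (chartDeriv_boundaryTangent_pos hj ht))
    ((chartPartition S).nonneg i _)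

end Stokes

section Hamiltonian

variable {E : Type*} [NormedAddCommGroup E] [NormedSpace ℝ E] [FiniteDimensional ℝ E]
  {H : Type*} [TopologicalSpace H] {I : ModelWithCorners ℝ E H}
  {M : Type*} [TopologicalSpace M] [ChartedSpace H M]

/-- Non-degeneracy of an alternating bilinear form, in the shape in which it occurs for the values
of a symplectic form. -/
def IsNondegenerate {V : Type*} [AddCommGroup V] [Module ℝ V] [TopologicalSpace V]
    (φ : V [⋀^Fin 2]→L[ℝ] ℝ) : Prop :=
  ∀ v, (∀ w, φ ![v, w] = 0) → v = 0

theorem IsNondegenerate.exists_dual {V : Type*} [AddCommGroup V] [Module ℝ V] [TopologicalSpace V]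
    [FiniteDimensional ℝ V] {φ : V [⋀^Fin 2]→L[ℝ] ℝ} (hφ : IsNondegenerate φ) (η : V →ₗ[ℝ] ℝ) :
    ∃ X, ∀ w, φ ![X, w] = η w := by
  let L : V →ₗ[ℝ] Module.Dual ℝ V :=
    LinearMap.mk₂ ℝ (fun v w => φ ![v, w]) (twoForm_add_left φ) (twoForm_smul_left φ)
      (twoForm_add_right φ) (twoForm_smul_right φ)
  have injective : Function.Injective L := by
    rw [← LinearMap.ker_eq_bot, LinearMap.ker_eq_bot']
    exact fun v hv => hφ v fun w => DFunLike.congr_fun hv w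
  obtain ⟨X, hX⟩ := (LinearMap.injective_iff_surjective_of_finrank_eq_finrank
    Subspace.dual_finrank_eq.symm).1 injective η
  exact ⟨X, fun w => DFunLike.congr_fun hX w⟩

variable {Ω : DForm I M 2} {x : M} (hΩ : IsNondegenerate (Ω x))
include hΩ

theorem apply_hamVF (f : M → ℝ) (v : TangentSpace I x) :
    Ω x ![hamVF I Ω f x, v] = differential I f x v := by
  have : FiniteDimensional ℝ (TangentSpace I x) := inferInstanceAs (FiniteDimensional ℝ E)
  have exists_dual : ∃ X : TangentSpace I x, ∀ w : TangentSpace I x,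
      Ω x ![X, w] = (fun v => (mfderiv I 𝓘(ℝ, ℝ) f x v : ℝ)) w :=
    hΩ.exists_dual (differential I f x : TangentSpace I x →ₗ[ℝ] ℝ)
  rw [show hamVF I Ω f x = exists_dual.choose from dif_pos exists_dual]
  exact exists_dual.choose_spec v

theorem differential_hamVF_self (f : M → ℝ) : differential I f x (hamVF I Ω f x) = 0 := by
  rw [← apply_hamVF hΩ, twoForm_self]

theorem hamVF_eq_smul {f g : M → ℝ} {r : ℝ} (h : differential I f x = r • differential I g x) :
    hamVF I Ω f x = r • hamVF I Ω g x := by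
  refine sub_eq_zero.1 (hΩ _ fun w => ?_)
  rw [twoForm_sub_left, twoForm_smul_left, apply_hamVF hΩ, apply_hamVF hΩ, h]
  exact sub_self _

end Hamiltonian

section FunctionForms

variable {E : Type*} [NormedAddCommGroup E] [NormedSpace ℝ E]
  {H : Type*} [TopologicalSpace H] {I : ModelWithCorners ℝ E H}
  {M : Type*} [TopologicalSpace M] [ChartedSpace H M]
  {E' : Type*} [NormedAddCommGroup E'] [NormedSpace ℝ E']
  {H' : Type*} [TopologicalSpace H'] {I' : ModelWithCorners ℝ E' H'}
  {M' : Type*} [TopologicalSpace M'] [ChartedSpace H' M']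

variable (I I') in
/-- The expression of a function-valued one-form in the preferred charts around `z₀` and `w₀`,
with the point of `M'` as a second variable. -/
def funFormInCharts (K : FunForm I M M') (z₀ : M) (w₀ : M') (p : E × E') : E [⋀^Fin 1]→L[ℝ] ℝ :=
  formInChart I (fun z => K z ((extChartAt I' w₀).symm p.2)) z₀ p.1

theorem formInChart_graph (K : FunForm I M M') {u : M → M'} {z₀ : M} {w₀ : M'} {y : E}
    (hw : u ((extChartAt I z₀).symm y) ∈ (extChartAt I' w₀).source) :
    formInChart I (fun z => K z (u z)) z₀ y =
      funFormInCharts I I' K z₀ w₀ (y, mapInCharts I I' u z₀ w₀ y) := by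
  simp only [formInChart, funFormInCharts, Function.comp_apply, (extChartAt I' w₀).left_inv hw]

theorem formInChart_graph_eventuallyEq (K : FunForm I M M') {u : M → M'} {z₀ : M} {w₀ : M'} {y : E}
    (hy : y ∈ (extChartAt I z₀).target) (hu : ContinuousAt u ((extChartAt I z₀).symm y))
    (hw : u ((extChartAt I z₀).symm y) ∈ (extChartAt I' w₀).source) :
    ∀ᶠ y' in 𝓝[Set.range I] y,
      (y', mapInCharts I I' u z₀ w₀ y') ∈
        (extChartAt I z₀).target ×ˢ (extChartAt I' w₀).target ∧
      formInChart I (fun z => K z (u z)) z₀ y' =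
        funFormInCharts I I' K z₀ w₀ (y', mapInCharts I I' u z₀ w₀ y') := by
  filter_upwards [target_inter_preimage_mem_nhdsWithin hy hu (extChartAt_source_mem_nhds' hw)]
    with y' ⟨hy', huy'⟩
  exact ⟨⟨hy', (extChartAt I' w₀).map_source huy'⟩, formInChart_graph K huy'⟩

theorem SmoothFunForm.smoothForm_graph [IsManifold I ∞ M] [IsManifold I' ∞ M']
    {K : FunForm I M M'} (hK : SmoothFunForm I I' K)
    {u : M → M'} (hu : ContMDiff I I' ∞ u) : SmoothForm I (fun z => K z (u z)) := by
  intro z₀ y hy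
  set w₀ := u ((extChartAt I z₀).symm y)
  have hw : u ((extChartAt I z₀).symm y) ∈ (extChartAt I' w₀).source := mem_extChartAt_source _
  have eventually_graph := formInChart_graph_eventuallyEq K hy hu.continuous.continuousAt hw
  have at_point := eventually_graph.self_of_nhdsWithin (extChartAt_target_subset_range z₀ hy)
  have smooth_comp := (hK z₀ w₀ _ at_point.1).comp_of_preimage_mem_nhdsWithin y
    (contDiffWithinAt_id.prodMk (contDiffWithinAt_mapInCharts hy hu.contMDiffAt hw))
    (eventually_graph.mono fun _ h => h.1)
  exact (smooth_comp.congr_of_eventuallyEq (eventually_graph.mono fun _ h => h.2) at_point.2).mono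
    (extChartAt_target_subset_range z₀)

variable (I I') in
/-- The derivative of a function-valued one-form, expressed in the preferred charts around `z`
and `w`, at the point `(z, w)`. -/
def funFormDeriv (K : FunForm I M M') (z : M) (w : M') : E × E' →L[ℝ] E [⋀^Fin 1]→L[ℝ] ℝ :=
  fderivWithin ℝ (funFormInCharts I I' K z w) (Set.range I ×ˢ Set.range I')
    (extChartAt I z z, extChartAt I' w w)

variable {K : FunForm I M M'} (hK : SmoothFunForm I I' K) (z : M) (w : M')
include hK

theorem SmoothFunForm.hasFDerivWithinAt :
    HasFDerivWithinAt (funFormInCharts I I' K z w) (funFormDeriv I I' K z w)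
      (Set.range I ×ˢ Set.range I') (extChartAt I z z, extChartAt I' w w) := by
  have prod_target_mem : (extChartAt I z).target ×ˢ (extChartAt I' w).target ∈
      𝓝[Set.range I ×ˢ Set.range I'] (extChartAt I z z, extChartAt I' w w) := by
    rw [nhdsWithin_prod_eq]
    exact Filter.prod_mem_prod (extChartAt_target_mem_nhdsWithin z)
      (extChartAt_target_mem_nhdsWithin w)
  exact (((hK z w _ ⟨mem_extChartAt_target z, mem_extChartAt_target w⟩).mono_of_mem_nhdsWithin
    prod_target_mem).differentiableWithinAt (by simp)).hasFDerivWithinAt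

theorem SmoothFunForm.hasFDerivWithinAt_formInChart_graph {u : M → M'}
    (hu : MDifferentiableAt I I' u z) :
    HasFDerivWithinAt (formInChart I (fun z => K z (u z)) z)
      (funFormDeriv I I' K z (u z) ∘L (ContinuousLinearMap.id ℝ E).prod
        (mfderiv I I' u z : E →L[ℝ] E')) (Set.range I) (extChartAt I z z) := by
  have apply_symm : (extChartAt I z).symm (extChartAt I z z) = z := extChartAt_to_inv z
  have eventually_graph := formInChart_graph_eventuallyEq (I' := I') K (u := u) (w₀ := u z)
    (mem_extChartAt_target z) (by rw [apply_symm]; exact hu.continuousAt)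
    (by rw [apply_symm]; exact mem_extChartAt_source _)
  have deriv_graph : HasFDerivWithinAt (fun y => (y, mapInCharts I I' u z (u z) y))
      ((ContinuousLinearMap.id ℝ E).prod (mfderiv I I' u z : E →L[ℝ] E')) (Set.range I)
      (extChartAt I z z) :=
    (hasFDerivWithinAt_id _ _).prodMk hu.hasMFDerivAt.2
  have deriv_K : HasFDerivWithinAt (funFormInCharts I I' K z (u z)) (funFormDeriv I I' K z (u z))
      (Set.range I ×ˢ Set.range I')
      (extChartAt I z z, mapInCharts I I' u z (u z) (extChartAt I z z)) := by
    simp only [Function.comp_apply, apply_symm]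
    exact hK.hasFDerivWithinAt z (u z)
  have deriv_comp := HasFDerivWithinAt.comp (t := Set.range I ×ˢ Set.range I')
    (extChartAt I z z) deriv_K deriv_graph fun y hy => ⟨hy, Set.mem_range_self _⟩
  exact deriv_comp.congr_of_eventuallyEq (eventually_graph.mono fun _ h => h.2)
    (eventually_graph.self_of_nhdsWithin (Set.mem_range_self _)).2

theorem SmoothFunForm.hasFDerivWithinAt_formInChart_const :
    HasFDerivWithinAt (formInChart I (fun z' => K z' w) z)
      (funFormDeriv I I' K z w ∘L ContinuousLinearMap.inl ℝ E E') (Set.range I)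
      (extChartAt I z z) := by
  have deriv_prodMk : HasFDerivWithinAt (fun y => (y, extChartAt I' w w))
      (ContinuousLinearMap.inl ℝ E E') (Set.range I) (extChartAt I z z) :=
    (hasFDerivAt_prodMk_left _ _).hasFDerivWithinAt
  have deriv_comp := HasFDerivWithinAt.comp (t := Set.range I ×ˢ Set.range I')
    (extChartAt I z z) (hK.hasFDerivWithinAt z w) deriv_prodMk
    fun y hy => ⟨hy, Set.mem_range_self _⟩
  refine deriv_comp.congr_of_eventuallyEq (.of_forall fun y => ?_) ?_ <;>
    simp only [funFormInCharts, Function.comp_apply, extChartAt_to_inv]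

theorem SmoothFunForm.differential_apply [IsManifold I 1 M] (ζ : TangentSpace I z)
    (v : TangentSpace I' w) :
    differential I' (fun w' => K z w' ![ζ]) w v =
      funFormDeriv I I' K z w (0, v) ![(ζ : E)] := by
  have deriv_slice := (ContinuousAlternatingMap.apply ℝ E ℝ ![(ζ : E)]).hasFDerivAt
    |>.comp_hasFDerivWithinAt _ (HasFDerivWithinAt.comp (t := Set.range I ×ˢ Set.range I') _
      (hK.hasFDerivWithinAt z w)
      (hasFDerivAt_prodMk_right (extChartAt I z z) (extChartAt I' w w)).hasFDerivWithinAt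
      fun q hq => ⟨Set.mem_range_self _, hq⟩)
  have slice_eq : ∀ q : E', K z ((extChartAt I' w).symm q) ![ζ] =
      funFormInCharts I I' K z w (extChartAt I z z, q) ![(ζ : E)] := fun q => by
    rw [funFormInCharts, formInChart_self]
    rfl
  have continuousAt_slice : ContinuousAt (fun w' => K z w' ![ζ]) w := by
    have continuousAt_comp := (continuousWithinAt_univ _ _).1 <|
      deriv_slice.continuousWithinAt.comp (f := extChartAt I' w) (x := w) (s := Set.univ)
        (continuousAt_extChartAt (I := I') w).continuousWithinAt fun _ _ => Set.mem_range_self _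
    refine continuousAt_comp.congr ?_
    filter_upwards [extChartAt_source_mem_nhds (I := I') w] with w' hw'
    have at_w' := slice_eq (extChartAt I' w w')
    rw [(extChartAt I' w).left_inv hw'] at at_w'
    exact at_w'.symm
  have hasMFDerivAt_slice : HasMFDerivAt I' 𝓘(ℝ, ℝ) (fun w' => K z w' ![ζ]) w
      (ContinuousAlternatingMap.apply ℝ E ℝ ![(ζ : E)] ∘L funFormDeriv I I' K z w ∘L
        ContinuousLinearMap.inr ℝ E E' : E' →L[ℝ] ℝ) :=
    ⟨continuousAt_slice, deriv_slice.congr (fun q _ => slice_eq q) (slice_eq _)⟩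
  rw [differential, hasMFDerivAt_slice.mfderiv]
  rfl

theorem SmoothFunForm.extD_graph_apply [IsManifold I 1 M] {u : M → M'}
    (hu : MDifferentiableAt I I' u z) (ξ ξ' : TangentSpace I z) :
    extD I (fun z => K z (u z)) z ![ξ, ξ'] = extD I (fun z' => K z' (u z)) z ![ξ, ξ'] +
      differential I' (fun w => K z w ![ξ']) (u z) (mfderiv I I' u z ξ) -
      differential I' (fun w => K z w ![ξ]) (u z) (mfderiv I I' u z ξ') := by
  set D : E × E' →L[ℝ] E [⋀^Fin 1]→L[ℝ] ℝ := funFormDeriv I I' K z (u z)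
  have uniqueDiff : UniqueDiffWithinAt ℝ (Set.range I) (extChartAt I z z) :=
    I.uniqueDiffOn _ (Set.mem_range_self _)
  have split : ∀ (a b : E) (a' : E'), D (a, a') ![b] = D (a, 0) ![b] + D (0, a') ![b] :=
    fun a b a' => by
      rw [← ContinuousAlternatingMap.add_apply, ← map_add, Prod.mk_add_mk, add_zero, zero_add]
  have extD_graph := extDerivWithin_oneForm_apply (formInChart I (fun z => K z (u z)) z)
    (Set.range I) (extChartAt I z z) (ξ : E) (ξ' : E)
  have extD_const := extDerivWithin_oneForm_apply (formInChart I (fun z' => K z' (u z)) z)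
    (Set.range I) (extChartAt I z z) (ξ : E) (ξ' : E)
  rw [(hK.hasFDerivWithinAt_formInChart_graph z hu).fderivWithin uniqueDiff] at extD_graph
  rw [(hK.hasFDerivWithinAt_formInChart_const z (u z)).fderivWithin uniqueDiff] at extD_const
  rw [extD_eq_extDerivWithin, extD_eq_extDerivWithin, hK.differential_apply, hK.differential_apply]
  refine extD_graph.trans (Eq.trans ?_ (congrArg (fun t : ℝ =>
    t + D (0, mfderiv I I' u z ξ) ![(ξ' : E)] - D (0, mfderiv I I' u z ξ') ![(ξ : E)])
    extD_const.symm))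
  change D (ξ, mfderiv I I' u z ξ) ![(ξ' : E)] - D (ξ', mfderiv I I' u z ξ') ![(ξ : E)] =
    D (ξ, 0) ![(ξ' : E)] - D (ξ', 0) ![(ξ : E)] + D (0, mfderiv I I' u z ξ) ![(ξ' : E)] -
      D (0, mfderiv I I' u z ξ') ![(ξ : E)]
  linear_combination split ξ ξ' (mfderiv I I' u z ξ) - split ξ' ξ (mfderiv I I' u z ξ')

end FunctionForms

section LocalBehaviour

variable {E : Type*} [NormedAddCommGroup E] [NormedSpace ℝ E]
  {H : Type*} [TopologicalSpace H] {I : ModelWithCorners ℝ E H}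
  {M : Type*} [TopologicalSpace M] [ChartedSpace H M]

theorem hasFDerivWithinAt_comp_extChartAt_symm [IsManifold I 1 M] {f : M → ℝ} {z₀ : M} {y : E}
    (hy : y ∈ (extChartAt I z₀).target)
    (hf : MDifferentiableAt I 𝓘(ℝ, ℝ) f ((extChartAt I z₀).symm y)) :
    HasFDerivWithinAt (f ∘ (extChartAt I z₀).symm)
      (differential I f ((extChartAt I z₀).symm y) ∘L chartSymmDeriv I z₀ y) (Set.range I) y := by
  have hasMFDeriv_symm : HasMFDerivWithinAt 𝓘(ℝ, E) I (extChartAt I z₀).symm (Set.range I) y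
      (chartSymmDeriv I z₀ y) :=
    (mdifferentiableWithinAt_extChartAt_symm hy).hasMFDerivWithinAt
  exact (hf.hasMFDerivAt.comp_hasMFDerivWithinAt y hasMFDeriv_symm).hasFDerivWithinAt

theorem differential_nonneg_of_inward {n : ℕ} [NeZero n] {S : Type*}
    [TopologicalSpace S] [ChartedSpace (EuclideanHalfSpace n) S] [IsManifold (𝓡∂ n) 1 S]
    {f : S → ℝ} {z i : S} (hmin : IsLocalMin f z) (hz : z ∈ (extChartAt (𝓡∂ n) i).source)
    (hf : MDifferentiableAt (𝓡∂ n) 𝓘(ℝ, ℝ) f z) {v : TangentSpace (𝓡∂ n) z}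
    (hv : 0 < chartDeriv (𝓡∂ n) i z v 0) : 0 ≤ differential (𝓡∂ n) f z v := by
  obtain ⟨y, hy, rfl⟩ : ∃ y ∈ (extChartAt (𝓡∂ n) i).target, (extChartAt (𝓡∂ n) i).symm y = z :=
    ⟨_, (extChartAt (𝓡∂ n) i).map_source hz, (extChartAt (𝓡∂ n) i).left_inv hz⟩
  have localMin_chart : IsLocalMinOn (f ∘ (extChartAt (𝓡∂ n) i).symm) (Set.range (𝓡∂ n)) y :=
    (continuousAt_extChartAt_symm'' hy).continuousWithinAt.eventually hmin
  have mem_tangentCone : chartDeriv (𝓡∂ n) i _ v ∈ posTangentConeAt (Set.range (𝓡∂ n)) y := by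
    have y_mem_range := extChartAt_target_subset_range i hy
    refine mem_posTangentConeAt_of_segment_subset
      ((𝓡∂ n).convex_range.segment_subset y_mem_range ?_)
    rw [range_modelWithCornersEuclideanHalfSpace] at y_mem_range ⊢
    exact add_nonneg y_mem_range hv.le
  have deriv_nonneg := localMin_chart.hasFDerivWithinAt_nonneg
    (hasFDerivWithinAt_comp_extChartAt_symm hy hf) mem_tangentCone
  rwa [ContinuousLinearMap.comp_apply, chartSymmDeriv_chartDeriv hy] at deriv_nonneg

theorem eventually_eq_of_differential_eq_zero [IsManifold I 1 M] {f : M → ℝ} {z : M}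
    (hf : ∀ᶠ z' in 𝓝 z, MDifferentiableAt I 𝓘(ℝ, ℝ) f z' ∧ differential I f z' = 0) :
    ∀ᶠ z' in 𝓝 z, f z' = f z := by
  have nhds_chart := target_inter_preimage_mem_nhdsWithin (f := (id : M → M))
    (mem_extChartAt_target (I := I) z) continuousAt_id
    (V := {z' | MDifferentiableAt I 𝓘(ℝ, ℝ) f z' ∧ differential I f z' = 0})
    (by rw [extChartAt_to_inv]; exact hf)
  obtain ⟨r, r_pos, ball_subset⟩ := Metric.mem_nhdsWithin_iff.1 nhds_chart
  set D := Metric.ball (extChartAt I z z) r ∩ Set.range I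
  have deriv_zero : ∀ y ∈ D, HasFDerivWithinAt (f ∘ (extChartAt I z).symm) (0 : E →L[ℝ] ℝ) D y := by
    intro y hy
    obtain ⟨y_mem_target, f_diff, f_deriv⟩ := ball_subset hy
    have has_deriv := hasFDerivWithinAt_comp_extChartAt_symm y_mem_target f_diff
    rw [show differential I f ((extChartAt I z).symm y) = 0 from f_deriv,
      ContinuousLinearMap.zero_comp] at has_deriv
    exact has_deriv.mono Set.inter_subset_right
  have center_mem : extChartAt I z z ∈ D := ⟨Metric.mem_ball_self r_pos, Set.mem_range_self _⟩
  have convex_D : Convex ℝ D := (convex_ball _ _).inter I.convex_range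
  filter_upwards [(continuousAt_extChartAt (I := I) z).preimage_mem_nhds
    (Metric.ball_mem_nhds _ r_pos), extChartAt_source_mem_nhds (I := I) z]
    with z' mem_ball mem_source
  have norm_le := convex_D.norm_image_sub_le_of_norm_hasFDerivWithin_le (C := 0)
    (f' := fun _ => (0 : E →L[ℝ] ℝ)) deriv_zero (fun _ _ => norm_zero.le) center_mem
    ⟨mem_ball, Set.mem_range_self _⟩
  rw [zero_mul, Function.comp_apply, Function.comp_apply, (extChartAt I z).left_inv mem_source,
    extChartAt_to_inv] at norm_le
  exact sub_eq_zero.1 (norm_le_zero_iff.1 norm_le)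

end LocalBehaviour

section Energy

variable {E : Type*} [NormedAddCommGroup E] [NormedSpace ℝ E]
  {H : Type*} [TopologicalSpace H] {I : ModelWithCorners ℝ E H}
  {M : Type*} [TopologicalSpace M] [ChartedSpace H M]
  {E' : Type*} [NormedAddCommGroup E'] [NormedSpace ℝ E']
  {H' : Type*} [TopologicalSpace H'] {I' : ModelWithCorners ℝ E' H'}
  {M' : Type*} [TopologicalSpace M'] [ChartedSpace H' M']

/-- A family of almost complex structures on `M'` that are tamed by `Ω`: the bilinear form
`Ω(·, J ·)` is positive, but in contrast to `IsCompatibleFamily` it need not be symmetric. -/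
structure IsTameFamily {ι : Type*} (Ω : DForm I' M' 2)
    (J : ι → ∀ w : M', TangentSpace I' w →L[ℝ] TangentSpace I' w) : Prop where
  sq : ∀ z w (v : TangentSpace I' w), J z w (J z w v) = -v
  pos : ∀ z w (v : TangentSpace I' w), v ≠ 0 → 0 < Ω w ![v, J z w v]

theorem IsTameFamily.isNondegenerate {ι : Type*} {Ω : DForm I' M' 2}
    {J : ι → ∀ w : M', TangentSpace I' w →L[ℝ] TangentSpace I' w} (hJ : IsTameFamily Ω J) (z : ι)
    (w : M') : IsNondegenerate (Ω w) := fun v hv =>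
  of_not_not fun v_ne_zero => (hJ.pos z w v v_ne_zero).ne' (hv _)

variable {Ω : DForm I' M' 2} {j : ∀ z : M, TangentSpace I z →L[ℝ] TangentSpace I z}
  {J : M → ∀ w : M', TangentSpace I' w →L[ℝ] TangentSpace I' w} {K : FunForm I M M'}
  {u : M → M'} {z : M} {ξ : TangentSpace I z}

theorem IsCompatibleFamily.isTameFamily (hJ : IsCompatibleFamily I I' Ω J) : IsTameFamily Ω J :=
  ⟨hJ.sq, hJ.pos⟩

variable (I Ω J K u z ξ) in
/-- The energy density `|du - X_K|²`, as the square of the length of the vector `(du - X_K)(ξ)`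
for the (possibly non-symmetric) form `Ω(·, J ·)`. -/
def energyDensity : ℝ :=
  Ω (u z) ![mfderiv I I' u z ξ - XK I I' Ω K z (u z) ξ,
    J z (u z) (mfderiv I I' u z ξ - XK I I' Ω K z (u z) ξ)]

variable (hJ : IsTameFamily Ω J)
include hJ

theorem energyDensity_nonneg : 0 ≤ energyDensity I Ω J K u z ξ := by
  by_cases h : mfderiv I I' u z ξ - XK I I' Ω K z (u z) ξ = 0
  · rw [energyDensity, h, map_zero, twoForm_self]
  · exact (hJ.pos z (u z) _ h).le

theorem mfderiv_eq_XK_of_energyDensity_eq_zero (h : energyDensity I Ω J K u z ξ = 0) :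
    mfderiv I I' u z ξ = XK I I' Ω K z (u z) ξ :=
  sub_eq_zero.1 (of_not_not fun ne_zero => (hJ.pos z (u z) _ ne_zero).ne' h)

theorem SolvesCR.apply_j (hCR : SolvesCR I I' Ω j J K u) (z : M) (ξ : TangentSpace I z) :
    mfderiv I I' u z (j z ξ) - XK I I' Ω K z (u z) (j z ξ) =
      J z (u z) (mfderiv I I' u z ξ - XK I I' Ω K z (u z) ξ) := by
  have equation := (smul_eq_zero.1 (hCR z ξ)).resolve_left (by norm_num)
  have J_equation := congrArg (J z (u z)) equation
  rw [map_add, hJ.sq, map_zero, ← sub_eq_add_neg, sub_eq_zero] at J_equation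
  exact J_equation.symm

theorem SolvesCR.energy_identity [IsManifold I ∞ M] [IsManifold I' ∞ M'] [FiniteDimensional ℝ E']
    (hCR : SolvesCR I I' Ω j J K u) (hK : SmoothFunForm I I' K) {β : DForm I M 1}
    (hβ : SmoothForm I β) (hu : ContMDiff I I' ∞ u) (z : M) (ξ : TangentSpace I z) :
    (pullback I I' u Ω z - extD I (fun z => β z - K z (u z)) z) ![ξ, j z ξ] =
      energyDensity I Ω J K u z ξ + curvatureTerm I I' Ω K β z (u z) ξ (j z ξ) := by
  have hΩ := hJ.isNondegenerate z (u z)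
  have : IsManifold I 1 M := IsManifold.of_le (n := ∞) (by simp)
  rw [energyDensity, ← hCR.apply_j hJ, ContinuousAlternatingMap.sub_apply,
    extD_sub hβ (hK.smoothForm_graph hu), ContinuousAlternatingMap.sub_apply,
    hK.extD_graph_apply z (hu.mdifferentiableAt (by simp)), pullback_apply_two, twoForm_sub_left,
    twoForm_sub_right, twoForm_sub_right,
    twoForm_swap (Ω (u z)) (mfderiv I I' u z ξ) (XK I I' Ω K z (u z) (j z ξ)),
    curvatureTerm, poisson, XK, XK, apply_hamVF hΩ, apply_hamVF hΩ, apply_hamVF hΩ]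
  ring

end Energy

section Collar

variable {m : ℕ}
  {W : Type*} [TopologicalSpace W] [ChartedSpace (EuclideanHalfSpace (2 * m + 2)) W]
  {Y : Type*} [TopologicalSpace Y] [ChartedSpace (EuclideanSpace ℝ (Fin (2 * m + 1))) Y]
  {Ω : DForm (𝓡∂ (2 * m + 2)) W 2} {θ : DForm (𝓡 (2 * m + 1)) Y 1} {c : ℝ}

local notation "𝓡W" => 𝓡∂ (2 * m + 2)
local notation "𝓡Y" => 𝓡 (2 * m + 1)
local notation "𝓡Yℝ" => ModelWithCorners.prod (𝓡 (2 * m + 1)) 𝓘(ℝ, ℝ)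
local notation "EY" => EuclideanSpace ℝ (Fin (2 * m + 1))

theorem SmoothForm.liouvilleForm [IsManifold 𝓡Y ∞ Y] (hθ : SmoothForm 𝓡Y θ) :
    SmoothForm 𝓡Yℝ (liouvilleForm θ) :=
  (hθ.pullback contMDiff_fst).smul contMDiff_snd

theorem extD_liouvilleForm_apply [IsManifold 𝓡Y ∞ Y] (hθ : SmoothForm 𝓡Y θ) (p : Y × ℝ)
    (a b : EY × ℝ) :
    extD 𝓡Yℝ (liouvilleForm θ) p ![a, b] =
      a.2 * θ p.1 ![b.1] - b.2 * θ p.1 ![a.1] + p.2 * extD 𝓡Y θ p.1 ![a.1, b.1] := by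
  have leibniz (a b : TangentSpace 𝓡Yℝ p) := extD_smul_apply (f := (Prod.snd : Y × ℝ → ℝ))
    mdifferentiableAt_snd (hθ.pullback contMDiff_fst) a b
  have pullback_extD (a b : TangentSpace 𝓡Yℝ p) :=
    pullback_apply_two (I := 𝓡Yℝ) (f := (Prod.fst : Y × ℝ → Y)) (η := extD 𝓡Y θ) a b
  simp only [extD_pullback hθ contMDiff_fst, pullback_apply_one, differential, mfderiv_snd,
    mfderiv_fst] at leibniz pullback_extD
  exact (leibniz a b).trans (congrArg (fun t : ℝ =>
    a.2 * θ p.1 ![b.1] - b.2 * θ p.1 ![a.1] + p.2 * t) (pullback_extD a b))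

theorem extD_liouvilleForm_radial [IsManifold 𝓡Y ∞ Y] (hθ : SmoothForm 𝓡Y θ) (p : Y × ℝ)
    (b : EY × ℝ) :
    extD 𝓡Yℝ (liouvilleForm θ) p ![((0, 1) : EY × ℝ), b] = θ p.1 ![b.1] := by
  have theta_zero : θ p.1 ![(0 : EY)] = 0 := (θ p.1).map_coord_zero 0 rfl
  have extD_theta_zero : extD 𝓡Y θ p.1 ![(0 : EY), b.1] = 0 :=
    (extD 𝓡Y θ p.1).map_coord_zero 0 rfl
  rw [extD_liouvilleForm_apply hθ, theta_zero, extD_theta_zero]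
  ring

namespace ConcaveBoundary

variable (B : ConcaveBoundary Ω θ c)

theorem le_rho {w : W} (hw : w ∈ B.collar.target) : c ≤ B.rho w := by
  have mem_source := B.collar.map_target hw
  rw [B.source_eq] at mem_source
  exact mem_source.2.1

theorem mem_boundary_iff {w : W} :
    w ∈ (𝓡W).boundary W ↔ w ∈ B.collar.target ∧ B.rho w = c := by
  rw [← B.boundary_eq]
  constructor
  · rintro ⟨⟨y, r⟩, ⟨-, rfl⟩, rfl⟩
    have mem_source : (y, r) ∈ B.collar.source := by
      rw [B.source_eq]
      exact ⟨Set.mem_univ _, le_rfl, lt_add_of_pos_right r B.ε_pos⟩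
    exact ⟨B.collar.map_source mem_source, congrArg Prod.snd (B.collar.left_inv mem_source)⟩
  · rintro ⟨hw, rho_eq⟩
    exact ⟨B.collar.symm w, ⟨Set.mem_univ _, rho_eq⟩, B.collar.right_inv hw⟩

theorem contMDiffAt_symm {w : W} (hw : w ∈ B.collar.target) :
    ContMDiffAt 𝓡W 𝓡Yℝ ∞ B.collar.symm w :=
  B.smooth_symm.contMDiffAt (B.isOpen_target.mem_nhds hw)

theorem contMDiffAt_rho {w : W} (hw : w ∈ B.collar.target) :
    ContMDiffAt 𝓡W 𝓘(ℝ, ℝ) ∞ B.rho w :=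
  contMDiff_snd.contMDiffAt.comp w (B.contMDiffAt_symm hw)

theorem contMDiffAt_proj {w : W} (hw : w ∈ B.collar.target) :
    ContMDiffAt 𝓡W 𝓡Y ∞ B.proj w :=
  contMDiff_fst.contMDiffAt.comp w (B.contMDiffAt_symm hw)

theorem mdifferentiableAt_rho {w : W} (hw : w ∈ B.collar.target) :
    MDifferentiableAt 𝓡W 𝓘(ℝ, ℝ) B.rho w :=
  (B.contMDiffAt_rho hw).mdifferentiableAt (by simp)

theorem mdifferentiableAt_proj {w : W} (hw : w ∈ B.collar.target) :
    MDifferentiableAt 𝓡W 𝓡Y B.proj w :=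
  (B.contMDiffAt_proj hw).mdifferentiableAt (by simp)

/-- The derivative of the collar, taken within its source because the collar is defined only for
`c ≤ ρ < c + ε`. -/
def collarDeriv (p : Y × ℝ) : EY × ℝ →L[ℝ] TangentSpace 𝓡W (B.collar p) :=
  mfderivWithin 𝓡Yℝ 𝓡W B.collar B.collar.source p

theorem hasMFDerivWithinAt_collar {p : Y × ℝ} (hp : p ∈ B.collar.source) :
    HasMFDerivWithinAt 𝓡Yℝ 𝓡W B.collar B.collar.source p (B.collarDeriv p) :=
  ((B.smooth p hp).mdifferentiableWithinAt (by simp)).hasMFDerivWithinAt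

theorem uniqueMDiffWithinAt_source {p : Y × ℝ} (hp : p ∈ B.collar.source) :
    UniqueMDiffWithinAt 𝓡Yℝ B.collar.source p := by
  have uniqueMDiffOn : UniqueMDiffOn 𝓡Yℝ ((Set.univ : Set Y) ×ˢ Set.Ico c (c + B.ε)) :=
    uniqueMDiffOn_univ.prod (uniqueDiffOn_Ico c (c + B.ε)).uniqueMDiffOn
  rw [B.source_eq] at hp ⊢
  exact uniqueMDiffOn p hp

theorem differential_rho_collarDeriv {p : Y × ℝ} (hp : p ∈ B.collar.source) (a : EY × ℝ) :
    differential 𝓡W B.rho (B.collar p) (B.collarDeriv p a) = a.2 := by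
  have rho_collar {q : Y × ℝ} (hq : q ∈ B.collar.source) : (B.rho ∘ B.collar) q = q.2 :=
    congrArg Prod.snd (B.collar.left_inv hq)
  have chain := (B.mdifferentiableAt_rho (B.collar.map_source hp)).hasMFDerivAt
    |>.comp_hasMFDerivWithinAt p (B.hasMFDerivWithinAt_collar hp)
  have deriv_snd : HasMFDerivWithinAt 𝓡Yℝ 𝓘(ℝ, ℝ) (B.rho ∘ B.collar) B.collar.source p
      (ContinuousLinearMap.snd ℝ EY ℝ) :=
    (hasMFDerivWithinAt_snd _ p).congr_mono (fun _ => rho_collar) (rho_collar hp) subset_rfl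
  exact DFunLike.congr_fun ((B.uniqueMDiffWithinAt_source hp).eq chain deriv_snd) a

theorem mfderiv_proj_collarDeriv {p : Y × ℝ} (hp : p ∈ B.collar.source) (a : EY × ℝ) :
    mfderiv 𝓡W 𝓡Y B.proj (B.collar p) (B.collarDeriv p a) = a.1 := by
  have proj_collar {q : Y × ℝ} (hq : q ∈ B.collar.source) : (B.proj ∘ B.collar) q = q.1 :=
    congrArg Prod.fst (B.collar.left_inv hq)
  have chain := (B.mdifferentiableAt_proj (B.collar.map_source hp)).hasMFDerivAt
    |>.comp_hasMFDerivWithinAt p (B.hasMFDerivWithinAt_collar hp)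
  have deriv_fst : HasMFDerivWithinAt 𝓡Yℝ 𝓡Y (B.proj ∘ B.collar) B.collar.source p
      (ContinuousLinearMap.fst ℝ EY ℝ) :=
    (hasMFDerivWithinAt_fst _ p).congr_mono (fun _ => proj_collar) (proj_collar hp) subset_rfl
  exact DFunLike.congr_fun ((B.uniqueMDiffWithinAt_source hp).eq chain deriv_fst) a

theorem collarDeriv_surjective {p : Y × ℝ} (hp : p ∈ B.collar.source) :
    Function.Surjective (B.collarDeriv p) := by
  have : FiniteDimensional ℝ (TangentSpace 𝓡W (B.collar p)) :=
    inferInstanceAs (FiniteDimensional ℝ (EuclideanSpace ℝ (Fin (2 * m + 2))))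
  have finrank_eq :
      Module.finrank ℝ (EY × ℝ) = Module.finrank ℝ (TangentSpace 𝓡W (B.collar p)) := by
    rw [Module.finrank_prod, finrank_euclideanSpace_fin, Module.finrank_self]
    exact (finrank_euclideanSpace_fin (𝕜 := ℝ) (n := 2 * m + 2)).symm
  have injective : Function.Injective (B.collarDeriv p).toLinearMap := by
    rw [← LinearMap.ker_eq_bot, LinearMap.ker_eq_bot']
    intro a ha
    have deriv_eq_zero : B.collarDeriv p a = 0 := ha
    have snd_eq := B.differential_rho_collarDeriv hp a
    have fst_eq := B.mfderiv_proj_collarDeriv hp a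
    rw [deriv_eq_zero, map_zero] at snd_eq fst_eq
    exact Prod.ext fst_eq.symm snd_eq.symm
  exact (LinearMap.injective_iff_surjective_of_finrank_eq_finrank finrank_eq).1 injective

theorem form_collarDeriv {p : Y × ℝ} (hp : p ∈ B.collar.source) (a b : EY × ℝ) :
    Ω (B.collar p) ![B.collarDeriv p a, B.collarDeriv p b] =
      extD 𝓡Yℝ (liouvilleForm θ) p ![a, b] := by
  rw [← B.symplectic p hp]
  exact (compContinuousLinearMap_vecCons_two _ _ _ _).symm

theorem form_collarDeriv_radial [IsManifold 𝓡Y ∞ Y] (hθ : SmoothForm 𝓡Y θ) {p : Y × ℝ}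
    (hp : p ∈ B.collar.source) (v : TangentSpace 𝓡W (B.collar p)) :
    Ω (B.collar p) ![B.collarDeriv p (0, 1), v] =
      pullback 𝓡W 𝓡Y B.proj θ (B.collar p) ![v] := by
  obtain ⟨b, rfl⟩ := B.collarDeriv_surjective hp v
  rw [B.form_collarDeriv hp, extD_liouvilleForm_radial hθ, pullback_apply_one,
    B.mfderiv_proj_collarDeriv hp]
  have apply_congr {y y' : Y} (h : y = y') (e : EY) : θ y ![e] = θ y' ![e] := by
    subst h
    rfl
  exact apply_congr (congrArg Prod.fst (B.collar.left_inv hp)).symm b.1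

theorem theta_hamVF_rho [IsManifold 𝓡Y ∞ Y] (hθ : SmoothForm 𝓡Y θ) {w : W}
    (hΩ : IsNondegenerate (Ω w)) (hw : w ∈ B.collar.target) :
    pullback 𝓡W 𝓡Y B.proj θ w ![hamVF 𝓡W Ω B.rho w] = -1 := by
  obtain ⟨p, hp, rfl⟩ : ∃ p ∈ B.collar.source, B.collar p = w :=
    ⟨_, B.collar.map_target hw, B.collar.right_inv hw⟩
  rw [← B.form_collarDeriv_radial hθ hp, twoForm_swap, apply_hamVF hΩ,
    B.differential_rho_collarDeriv hp]

section Curves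

variable {E : Type*} [NormedAddCommGroup E] [NormedSpace ℝ E]
  {H : Type*} [TopologicalSpace H] {I : ModelWithCorners ℝ E H}
  {M : Type*} [TopologicalSpace M] [ChartedSpace H M]
  {K : FunForm I M W} {α β : DForm I M 1} {u : M → W} {z : M}

theorem XK_eq_smul {w : W} (hΩ : IsNondegenerate (Ω w)) (hw : w ∈ B.collar.target)
    (hK : ∀ᶠ w' in 𝓝 w, K z w' = B.rho w' • α z + β z) (ξ : TangentSpace I z) :
    XK I 𝓡W Ω K z w ξ = α z ![ξ] • hamVF 𝓡W Ω B.rho w := by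
  refine hamVF_eq_smul hΩ ?_
  have eventually_affine :
      (fun w' => K z w' ![ξ]) =ᶠ[𝓝 w] fun w' => α z ![ξ] * B.rho w' + β z ![ξ] := by
    filter_upwards [hK] with w' hw'
    rw [hw', ContinuousAlternatingMap.add_apply, ContinuousAlternatingMap.smul_apply, smul_eq_mul,
      mul_comm]
  have deriv_affine : HasFDerivAt (fun t : ℝ => α z ![ξ] * t + β z ![ξ])
      (α z ![ξ] • ContinuousLinearMap.id ℝ ℝ) (B.rho w) :=
    ((hasFDerivAt_id (B.rho w)).const_mul (α z ![ξ])).add_const (β z ![ξ])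
  have chain := (deriv_affine.hasMFDerivAt.comp w
    (B.mdifferentiableAt_rho hw).hasMFDerivAt).congr_of_eventuallyEq eventually_affine
  exact chain.mfderiv

theorem mdifferentiableAt_rho_comp (hw : u z ∈ B.collar.target)
    (hu : MDifferentiableAt I 𝓡W u z) : MDifferentiableAt I 𝓘(ℝ, ℝ) (B.rho ∘ u) z :=
  (B.mdifferentiableAt_rho hw).comp z hu

theorem differential_rho_comp (hw : u z ∈ B.collar.target) (hu : MDifferentiableAt I 𝓡W u z)
    (ξ : TangentSpace I z) :
    differential I (B.rho ∘ u) z ξ = differential 𝓡W B.rho (u z) (mfderiv I 𝓡W u z ξ) :=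
  DFunLike.congr_fun (mfderiv_comp z (B.mdifferentiableAt_rho hw) hu) ξ

theorem pullback_proj_comp (hw : u z ∈ B.collar.target) (hu : MDifferentiableAt I 𝓡W u z)
    (ξ : TangentSpace I z) :
    pullback I 𝓡Y (B.proj ∘ u) θ z ![ξ] =
      pullback 𝓡W 𝓡Y B.proj θ (u z) ![mfderiv I 𝓡W u z ξ] := by
  rw [pullback_apply_one, pullback_apply_one, mfderiv_comp z (B.mdifferentiableAt_proj hw) hu]
  rfl

theorem differential_rho_comp_j [IsManifold 𝓡Y ∞ Y] (hθ : SmoothForm 𝓡Y θ)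
    {j : ∀ z : M, TangentSpace I z →L[ℝ] TangentSpace I z}
    {J : M → ∀ w : W, TangentSpace 𝓡W w →L[ℝ] TangentSpace 𝓡W w} (hJ : IsTameFamily Ω J)
    (hJcontact : B.IsContactType (J z)) (hCR : SolvesCR I 𝓡W Ω j J K u)
    (hz : u z ∈ (𝓡W).boundary W) (hu : MDifferentiableAt I 𝓡W u z)
    (hK : ∀ᶠ w in 𝓝 (u z), K z w = B.rho w • α z + β z) (τ : TangentSpace I z) :
    differential I (B.rho ∘ u) z (j z τ) =
      -(c * (pullback I 𝓡Y (B.proj ∘ u) θ z ![τ] + α z ![τ])) := by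
  obtain ⟨hw, rho_eq⟩ := B.mem_boundary_iff.1 hz
  have hΩ := hJ.isNondegenerate z (u z)
  have contact : differential 𝓡W B.rho (u z)
      (J z (u z) (mfderiv I 𝓡W u z τ - XK I 𝓡W Ω K z (u z) τ)) =
      -(B.rho (u z) * pullback 𝓡W 𝓡Y B.proj θ (u z)
        ![mfderiv I 𝓡W u z τ - XK I 𝓡W Ω K z (u z) τ]) :=
    hJcontact (u z) hz _
  rwa [← hCR.apply_j hJ, rho_eq, B.XK_eq_smul hΩ hw hK, B.XK_eq_smul hΩ hw hK, map_sub,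
    map_smul, differential_hamVF_self hΩ, smul_zero, sub_zero, oneForm_sub, oneForm_smul,
    B.theta_hamVF_rho hθ hΩ hw, ← B.pullback_proj_comp hw hu, ← B.differential_rho_comp hw hu,
    smul_eq_mul, mul_neg_one, sub_neg_eq_add] at contact

theorem isOpen_preimage_boundary [IsManifold I 1 M] (hΩ : ∀ z, IsNondegenerate (Ω (u z)))
    (hK : ∀ᶠ w in 𝓝ˢ ((𝓡W).boundary W), ∀ z, K z w = B.rho w • α z + β z)
    (hu : MDifferentiable I 𝓡W u)
    (hdu : ∀ z ξ, mfderiv I 𝓡W u z ξ = XK I 𝓡W Ω K z (u z) ξ) :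
    IsOpen (u ⁻¹' (𝓡W).boundary W) := by
  refine isOpen_iff_mem_nhds.2 fun z hz => ?_
  have hw := B.mem_boundary_iff.1 hz
  have eventually_collar : ∀ᶠ z' in 𝓝 z, u z' ∈ B.collar.target :=
    (hu z).continuousAt.eventually (B.isOpen_target.mem_nhds hw.1)
  have eventually_affine : ∀ᶠ z' in 𝓝 z, ∀ᶠ w in 𝓝 (u z'), ∀ z, K z w = B.rho w • α z + β z :=
    (hu z).continuousAt.eventually
      (eventually_eventually_nhds.2 (hK.filter_mono (nhds_le_nhdsSet (Set.mem_preimage.1 hz))))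
  have rho_locally_constant : ∀ᶠ z' in 𝓝 z, B.rho (u z') = B.rho (u z) := by
    refine eventually_eq_of_differential_eq_zero (I := I) (f := B.rho ∘ u) ?_
    filter_upwards [eventually_collar, eventually_affine] with z' hz' affine
    refine ⟨B.mdifferentiableAt_rho_comp hz' (hu z'), ContinuousLinearMap.ext fun ξ => ?_⟩
    rw [B.differential_rho_comp hz' (hu z'), hdu,
      B.XK_eq_smul (hΩ _) hz' (affine.mono fun _ h => h z'), map_smul,
      differential_hamVF_self (hΩ _), smul_zero, zero_apply]
  filter_upwards [eventually_collar, rho_locally_constant] with z' hz' rho_eq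
  exact B.mem_boundary_iff.2 ⟨hz', rho_eq.trans hw.2⟩

theorem range_subset_boundary_of_mfderiv_eq_XK [IsManifold I 1 M] [IsManifold 𝓡W ∞ W]
    (hΩ : ∀ z, IsNondegenerate (Ω (u z)))
    (hM : ∀ z, ∃ z' ∈ connectedComponent z, u z' ∈ (𝓡W).boundary W)
    (hK : ∀ᶠ w in 𝓝ˢ ((𝓡W).boundary W), ∀ z, K z w = B.rho w • α z + β z)
    (hu : MDifferentiable I 𝓡W u)
    (hdu : ∀ z ξ, mfderiv I 𝓡W u z ξ = XK I 𝓡W Ω K z (u z) ξ) :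
    Set.range u ⊆ (𝓡W).boundary W := by
  have isClosed : IsClosed (u ⁻¹' (𝓡W).boundary W) :=
    ((𝓡W).isClosed_boundary (n := ∞) (by simp)).preimage hu.continuous
  have isClopen : IsClopen (u ⁻¹' (𝓡W).boundary W) :=
    ⟨isClosed, B.isOpen_preimage_boundary hΩ hK hu hdu⟩
  rintro _ ⟨z, rfl⟩
  obtain ⟨z', hz', uz'_mem⟩ := hM z
  have component_subset := isClopen.connectedComponent_subset uz'_mem
  rw [← connectedComponent_eq hz'] at component_subset
  exact component_subset mem_connectedComponent

theorem pullback_proj_comp_eq_liouvilleForm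
    (hu : MDifferentiable I 𝓡Yℝ (B.collar.symm ∘ u)) (hub : Set.range u ⊆ (𝓡W).boundary W) :
    pullback I 𝓡Y (B.proj ∘ u) (fun y => c • θ y) =
      pullback I 𝓡Yℝ (B.collar.symm ∘ u) (liouvilleForm θ) := by
  funext z
  have rho_eq : B.rho (u z) = c := (B.mem_boundary_iff.1 (hub ⟨z, rfl⟩)).2
  have deriv_eq : mfderiv I 𝓡Y (B.proj ∘ u) z =
      mfderiv 𝓡Yℝ 𝓡Y (Prod.fst : Y × ℝ → Y) (B.collar.symm (u z)) ∘L
        mfderiv I 𝓡Yℝ (B.collar.symm ∘ u) z :=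
    mfderiv_comp (g := (Prod.fst : Y × ℝ → Y)) z mdifferentiableAt_fst (hu z)
  ext v
  change c * θ (B.proj (u z)) _ = B.rho (u z) * θ (B.proj (u z)) _
  rw [rho_eq, deriv_eq]
  rfl

theorem pullback_collar_comp {g : M → Y × ℝ} (hg : MDifferentiable I 𝓡Yℝ g)
    (hg_source : ∀ z, g z ∈ B.collar.source) :
    pullback I 𝓡W (B.collar ∘ g) Ω = pullback I 𝓡Yℝ g (extD 𝓡Yℝ (liouvilleForm θ)) := by
  funext z
  have chain := (B.hasMFDerivWithinAt_collar (hg_source z)).comp z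
    (hg z).hasMFDerivAt.hasMFDerivWithinAt (s := Set.univ) fun z' _ => hg_source z'
  rw [pullback, (hasMFDerivWithinAt_univ.1 chain).mfderiv, pullback,
    ← B.symplectic _ (hg_source z)]
  rfl

theorem pullback_eq_extD [IsManifold I ∞ M] [IsManifold 𝓡Y ∞ Y] (hθ : SmoothForm 𝓡Y θ)
    (hu : ContMDiff I 𝓡W ∞ u) (hub : Set.range u ⊆ (𝓡W).boundary W) :
    pullback I 𝓡W u Ω = extD I (pullback I 𝓡Y (B.proj ∘ u) (fun y => c • θ y)) := by
  have mem_target (z : M) : u z ∈ B.collar.target := (B.mem_boundary_iff.1 (hub ⟨z, rfl⟩)).1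
  have smooth : ContMDiff I 𝓡Yℝ ∞ (B.collar.symm ∘ u) := fun z =>
    (B.contMDiffAt_symm (mem_target z)).comp z (hu z)
  have factorization : B.collar ∘ B.collar.symm ∘ u = u :=
    funext fun z => B.collar.right_inv (mem_target z)
  rw [B.pullback_proj_comp_eq_liouvilleForm (smooth.mdifferentiable (by simp)) hub,
    extD_pullback hθ.liouvilleForm smooth,
    ← B.pullback_collar_comp (smooth.mdifferentiable (by simp)) fun z =>
      B.collar.map_target (mem_target z), factorization]

end Curves

section Surfaces

variable {S : Type*} [TopologicalSpace S] [ChartedSpace (EuclideanHalfSpace 2) S]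
  [IsManifold (𝓡∂ 2) ∞ S]
  {j : ∀ z : S, TangentSpace (𝓡∂ 2) z →L[ℝ] TangentSpace (𝓡∂ 2) z}
  {K : FunForm (𝓡∂ 2) S W} {α β : DForm (𝓡∂ 2) S 1} {u : S → W}

theorem differential_rho_comp_nonneg (hu : ContMDiff (𝓡∂ 2) 𝓡W ∞ u) {z i : S}
    (hz : u z ∈ (𝓡W).boundary W) (hi : z ∈ (extChartAt (𝓡∂ 2) i).source)
    {ν : TangentSpace (𝓡∂ 2) z} (hν : 0 < chartDeriv (𝓡∂ 2) i z ν 0) :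
    0 ≤ differential (𝓡∂ 2) (B.rho ∘ u) z ν := by
  have : IsManifold (𝓡∂ 2) 1 S := IsManifold.of_le (n := ∞) (by simp)
  obtain ⟨hw, rho_eq⟩ := B.mem_boundary_iff.1 hz
  refine differential_nonneg_of_inward ?_ hi
    (B.mdifferentiableAt_rho_comp hw (hu.mdifferentiableAt (by simp))) hν
  filter_upwards [hu.continuous.continuousAt.eventually (B.isOpen_target.mem_nhds hw)] with z' hz'
  exact rho_eq.trans_le (B.le_rho hz')

theorem continuousOn_formInChart_pullback_proj [IsManifold 𝓡Y ∞ Y] (hθ : SmoothForm 𝓡Y θ)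
    (hu : ContMDiff (𝓡∂ 2) 𝓡W ∞ u)
    (hu_boundary : ∀ z ∈ (𝓡∂ 2).boundary S, u z ∈ (𝓡W).boundary W) (i : S) :
    ContinuousOn
      (formInChart (𝓡∂ 2) (pullback (𝓡∂ 2) 𝓡Y (B.proj ∘ u) (fun y => c • θ y)) i)
      {y ∈ (extChartAt (𝓡∂ 2) i).target | y 0 = 0} := by
  have smooth_proj : ContMDiffOn (𝓡∂ 2) 𝓡Y ∞ (B.proj ∘ u) (u ⁻¹' B.collar.target) :=
    fun z hz => ((B.contMDiffAt_proj hz).comp z (hu z)).contMDiffWithinAt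
  intro y hy
  have mem_collar : (extChartAt (𝓡∂ 2) i).symm y ∈ u ⁻¹' B.collar.target :=
    (B.mem_boundary_iff.1 (hu_boundary _ (symm_mem_boundary hy.1 hy.2))).1
  exact (contDiffWithinAt_formInChart_pullback (hθ.const_smul c)
    (B.isOpen_target.preimage hu.continuous) smooth_proj hy.1 mem_collar).continuousWithinAt.mono
      fun y' hy' => extChartAt_target_subset_range i hy'.1

variable [T2Space S] [CompactSpace S]

theorem boundaryIntegral_pullback_proj_le [IsManifold 𝓡W ∞ W] [IsManifold 𝓡Y ∞ Y]
    (hθ : SmoothForm 𝓡Y θ) (hj : IsComplexStructure (𝓡∂ 2) j)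
    {J : S → ∀ w : W, TangentSpace 𝓡W w →L[ℝ] TangentSpace 𝓡W w} (hJ : IsTameFamily Ω J)
    (hJcontact : ∀ z ∈ (𝓡∂ 2).boundary S, B.IsContactType (J z))
    (hK : SmoothFunForm (𝓡∂ 2) 𝓡W K) (hβ : SmoothForm (𝓡∂ 2) β)
    (hKαβ : ∀ᶠ w in 𝓝ˢ ((𝓡W).boundary W), ∀ z, K z w = B.rho w • α z + β z)
    (hu : ContMDiff (𝓡∂ 2) 𝓡W ∞ u)
    (hu_boundary : ∀ z ∈ (𝓡∂ 2).boundary S, u z ∈ (𝓡W).boundary W)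
    (hCR : SolvesCR (𝓡∂ 2) 𝓡W Ω j J K u) :
    boundaryIntegral j (pullback (𝓡∂ 2) 𝓡Y (B.proj ∘ u) (fun y => c • θ y)) ≤
      boundaryIntegral j (fun z => β z - K z (u z)) := by
  refine boundaryIntegral_mono hj (B.continuousOn_formInChart_pullback_proj hθ hu hu_boundary)
    (fun i => ((hβ.sub (hK.smoothForm_graph hu)) i).continuousOn.mono fun y hy => hy.1)
    fun z hz i hi τ hτ => ?_
  have affine := (hKαβ.filter_mono (nhds_le_nhdsSet (hu_boundary z hz))).mono fun _ h => h z
  have inward := B.differential_rho_comp_nonneg hu (hu_boundary z hz) hi hτ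
  rw [B.differential_rho_comp_j hθ hJ (hJcontact z hz) hCR (hu_boundary z hz)
    (hu.mdifferentiableAt (by simp)) affine] at inward
  have graph_eq : (β z - K z (u z)) ![τ] = -(c * α z ![τ]) := by
    rw [affine.self_of_nhds, (B.mem_boundary_iff.1 (hu_boundary z hz)).2,
      ContinuousAlternatingMap.sub_apply, ContinuousAlternatingMap.add_apply,
      ContinuousAlternatingMap.smul_apply, smul_eq_mul]
    ring
  have pullback_eq : pullback (𝓡∂ 2) 𝓡Y (B.proj ∘ u) (fun y => c • θ y) z ![τ] =
      c * pullback (𝓡∂ 2) 𝓡Y (B.proj ∘ u) θ z ![τ] := rfl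
  rw [pullback_eq, graph_eq]
  linarith

theorem relClass_eq_surfaceIntegral_add [IsManifold 𝓡W ∞ W] (hΩ : SmoothForm 𝓡W Ω)
    (hj : IsComplexStructure (𝓡∂ 2) j) (hu : ContMDiff (𝓡∂ 2) 𝓡W ∞ u)
    {ζ : DForm (𝓡∂ 2) S 1} (hζ : SmoothForm (𝓡∂ 2) ζ) :
    B.relClass j u =
      surfaceIntegral j (fun z => pullback (𝓡∂ 2) 𝓡W u Ω z - extD (𝓡∂ 2) ζ z) +
      (boundaryIntegral j ζ -
        boundaryIntegral j (pullback (𝓡∂ 2) 𝓡Y (B.proj ∘ u) (fun y => c • θ y))) := by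
  have split := surfaceIntegral_add hj ((hΩ.pullback hu).sub hζ.extD) hζ.extD
  simp only [sub_add_cancel] at split
  rw [relClass, split, surfaceIntegral_extD hj hζ, add_sub_assoc]

theorem relClass_eq_zero [IsManifold 𝓡Y ∞ Y] (hθ : SmoothForm 𝓡Y θ)
    (hj : IsComplexStructure (𝓡∂ 2) j) (hu : ContMDiff (𝓡∂ 2) 𝓡W ∞ u)
    (hub : Set.range u ⊆ (𝓡W).boundary W) : B.relClass j u = 0 := by
  have smooth_proj : ContMDiff (𝓡∂ 2) 𝓡Y ∞ (B.proj ∘ u) := fun z =>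
    (B.contMDiffAt_proj (B.mem_boundary_iff.1 (hub ⟨z, rfl⟩)).1).comp z (hu z)
  rw [relClass, B.pullback_eq_extD hθ hu hub,
    surfaceIntegral_extD hj ((hθ.const_smul c).pullback smooth_proj), sub_self]

end Surfaces

end ConcaveBoundary

end Collar

end FloerPositivity

end

open FloerPositivity in
theorem mainTheorem8_general {m : ℕ}
    {W : Type*} [TopologicalSpace W] [ChartedSpace (EuclideanHalfSpace (2 * m + 2)) W]
    [IsManifold (𝓡∂ (2 * m + 2)) ∞ W]
    {Y : Type*} [TopologicalSpace Y] [ChartedSpace (EuclideanSpace ℝ (Fin (2 * m + 1))) Y]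
    [IsManifold (𝓡 (2 * m + 1)) ∞ Y]
    {Ω : DForm (𝓡∂ (2 * m + 2)) W 2} (hΩ : SmoothForm (𝓡∂ (2 * m + 2)) Ω)
    {θ : DForm (𝓡 (2 * m + 1)) Y 1} (hθ : SmoothForm (𝓡 (2 * m + 1)) θ)
    {c : ℝ} (B : ConcaveBoundary Ω θ c)
    {S : Type*} [TopologicalSpace S] [ChartedSpace (EuclideanHalfSpace 2) S]
    [IsManifold (𝓡∂ 2) ∞ S] [T2Space S] [CompactSpace S]
    (hS : ∀ z : S, (connectedComponent z ∩ (𝓡∂ 2).boundary S).Nonempty)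
    {j : ∀ z : S, TangentSpace (𝓡∂ 2) z →L[ℝ] TangentSpace (𝓡∂ 2) z}
    (hj : IsComplexStructure (𝓡∂ 2) j)
    {J : S → ∀ w : W, TangentSpace (𝓡∂ (2 * m + 2)) w →L[ℝ] TangentSpace (𝓡∂ (2 * m + 2)) w}
    (hJ : IsTameFamily Ω J) (hJcontact : ∀ z ∈ (𝓡∂ 2).boundary S, B.IsContactType (J z))
    {K : FunForm (𝓡∂ 2) S W} (hK : SmoothFunForm (𝓡∂ 2) (𝓡∂ (2 * m + 2)) K)
    {α β : DForm (𝓡∂ 2) S 1} (hβ : SmoothForm (𝓡∂ 2) β)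
    (hKαβ : ∀ᶠ w in 𝓝ˢ ((𝓡∂ (2 * m + 2)).boundary W), ∀ z : S, K z w = B.rho w • α z + β z)
    {u : S → W} (hpos : ∀ (z : S) (ξ : TangentSpace (𝓡∂ 2) z),
      0 ≤ curvatureTerm (𝓡∂ 2) (𝓡∂ (2 * m + 2)) Ω K β z (u z) ξ (j z ξ))
    (hu : ContMDiff (𝓡∂ 2) (𝓡∂ (2 * m + 2)) ∞ u)
    (hu_boundary : ∀ z ∈ (𝓡∂ 2).boundary S, u z ∈ (𝓡∂ (2 * m + 2)).boundary W)
    (hCR : SolvesCR (𝓡∂ 2) (𝓡∂ (2 * m + 2)) Ω j J K u) :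
    0 ≤ B.relClass j u ∧
      (B.relClass j u = 0 ↔ Set.range u ⊆ (𝓡∂ (2 * m + 2)).boundary W) := by
  have : IsManifold (𝓡∂ 2) 1 S := IsManifold.of_le (n := ∞) (by simp)
  have smooth_primitive : SmoothForm (𝓡∂ 2) (fun z => β z - K z (u z)) :=
    hβ.sub (hK.smoothForm_graph hu)
  have energy_identity := hCR.energy_identity hJ hK hβ hu
  have energy_nonneg (z : S) (ξ : TangentSpace (𝓡∂ 2) z) := energyDensity_nonneg hJ (K := K)
    (u := u) (z := z) (ξ := ξ)
  have defect_nonneg (z : S) (ξ : TangentSpace (𝓡∂ 2) z) :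
      0 ≤ (pullback (𝓡∂ 2) (𝓡∂ (2 * m + 2)) u Ω z -
        extD (𝓡∂ 2) (fun z => β z - K z (u z)) z) ![ξ, j z ξ] :=
    (add_nonneg (energy_nonneg z ξ) (hpos z ξ)).trans_eq (energy_identity z ξ).symm
  have interior := surfaceIntegral_nonneg hj defect_nonneg
  have boundary := B.boundaryIntegral_pullback_proj_le hθ hj hJ hJcontact hK hβ hKαβ hu
    hu_boundary hCR
  have relClass_eq := B.relClass_eq_surfaceIntegral_add hΩ hj hu smooth_primitive
  refine ⟨by linarith, fun relClass_zero => ?_, B.relClass_eq_zero hθ hj hu⟩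
  have defect_zero := eq_zero_of_surfaceIntegral_eq_zero hj
    ((hΩ.pullback hu).sub smooth_primitive.extD) defect_nonneg (by linarith)
  refine B.range_subset_boundary_of_mfderiv_eq_XK (fun z => hJ.isNondegenerate z (u z))
    (fun z => (hS z).imp fun z' hz' => ⟨hz'.1, hu_boundary z' hz'.2⟩) hKαβ
    (hu.mdifferentiable (by simp)) fun z ξ => mfderiv_eq_XK_of_energyDensity_eq_zero hJ ?_
  linarith [energy_identity z ξ, defect_zero z ξ (j z ξ), energy_nonneg z ξ, hpos z ξ]

theorem mainTheorem8
    {m : ℕ}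
    -- the symplectic manifold `W` of dimension `2m + 2` and the contact manifold `Y`
    {W : Type*} [TopologicalSpace W] [ChartedSpace (EuclideanHalfSpace (2 * m + 2)) W]
    [IsManifold (𝓡∂ (2 * m + 2)) ∞ W] [T2Space W] [SecondCountableTopology W]
    {Y : Type*} [TopologicalSpace Y] [ChartedSpace (EuclideanSpace ℝ (Fin (2 * m + 1))) Y]
    [IsManifold (𝓡 (2 * m + 1)) ∞ Y] [T2Space Y] [SecondCountableTopology Y]
    (Ω : FloerPositivity.DForm (𝓡∂ (2 * m + 2)) W 2)
    (hΩ : FloerPositivity.IsSymplectic (𝓡∂ (2 * m + 2)) Ω)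
    (θ : FloerPositivity.DForm (𝓡 (2 * m + 1)) Y 1)
    (hθ : FloerPositivity.IsContactForm (𝓡 (2 * m + 1)) θ)
    (c : ℝ) (B : FloerPositivity.ConcaveBoundary Ω θ c)
    -- the compact Riemann surface `S`, every component of which has boundary
    {S : Type*} [TopologicalSpace S] [ChartedSpace (EuclideanHalfSpace 2) S]
    [IsManifold (𝓡∂ 2) ∞ S] [T2Space S] [CompactSpace S]
    (hS : ∀ z : S, (connectedComponent z ∩ (𝓡∂ 2).boundary S).Nonempty)
    (j : ∀ z : S, TangentSpace (𝓡∂ 2) z →L[ℝ] TangentSpace (𝓡∂ 2) z)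
    (hj : FloerPositivity.IsComplexStructure (𝓡∂ 2) j)
    -- the almost complex structures and the Hamiltonian perturbation
    (J : S → ∀ w : W, TangentSpace (𝓡∂ (2 * m + 2)) w →L[ℝ] TangentSpace (𝓡∂ (2 * m + 2)) w)
    (hJ : FloerPositivity.IsCompatibleFamily (𝓡∂ 2) (𝓡∂ (2 * m + 2)) Ω J)
    (K : FloerPositivity.FunForm (𝓡∂ 2) S W)
    (hK : FloerPositivity.SmoothFunForm (𝓡∂ 2) (𝓡∂ (2 * m + 2)) K)
    -- `J_z` is of contact type along `∂W` for `z ∈ ∂S`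
    (hJcontact : ∀ z ∈ (𝓡∂ 2).boundary S, B.IsContactType (J z))
    -- `K = α ρ + β` near `∂W`
    (α β : FloerPositivity.DForm (𝓡∂ 2) S 1)
    (hα : FloerPositivity.SmoothForm (𝓡∂ 2) α) (hβ : FloerPositivity.SmoothForm (𝓡∂ 2) β)
    (hKαβ : ∀ᶠ w in 𝓝ˢ ((𝓡∂ (2 * m + 2)).boundary W), ∀ z : S, K z w = B.rho w • α z + β z)
    -- `d_S K - {K, K} - dβ ≥ 0`
    (hpos : ∀ (z : S) (ξ : TangentSpace (𝓡∂ 2) z) (w : W),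
      0 ≤ FloerPositivity.curvatureTerm (𝓡∂ 2) (𝓡∂ (2 * m + 2)) Ω K β z w ξ (j z ξ))
    -- the solution `u : (S, ∂S) → (W, ∂W)`
    (u : S → W) (hu : ContMDiff (𝓡∂ 2) (𝓡∂ (2 * m + 2)) ∞ u)
    (hu_boundary : ∀ z ∈ (𝓡∂ 2).boundary S, u z ∈ (𝓡∂ (2 * m + 2)).boundary W)
    (hCR : FloerPositivity.SolvesCR (𝓡∂ 2) (𝓡∂ (2 * m + 2)) Ω j J K u) :
    0 ≤ B.relClass j u ∧
      (B.relClass j u = 0 ↔ Set.range u ⊆ (𝓡∂ (2 * m + 2)).boundary W) :=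
  mainTheorem8_general hΩ.smooth hθ.smooth B hS hj hJ.isTameFamily hJcontact hK hβ hKαβ
    (fun z ξ => hpos z ξ (u z)) hu hu_boundary hCR
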